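/- Let $\Gamma$ be a finite abstract simplicial complex, and let $a,b$ be free vertices of $\Gamma$ (a vertex is free if it is contained in exactly one facet), lying in the facets $E$ and $F$, respectively. Assume that $E\neq F$ and $|E|,|F|\ge 2$. Let $\Gamma+\langle ab\rangle$ denote the complex obtained from $\Gamma$ by adding the face $\{a,b\}$ (together with its subsets). If $\Gamma$ is vertex decomposable (respectively shellable, sequentially Cohen–Macaulay), then $\Gamma+\langle ab\rangle$ is vertex decomposable (respectively shellable, sequentially Cohen–Macaulay). If moreover $|E|,|F|\ge 3$, then the converse also holds: if $\Gamma+\langle ab\rangle$ is vertex decomposable (respectively shellable, sequentially Cohen–Macaulay), then so is $\Gamma$. The notions are the nonpure ones: - For a vertex $v$, $\Gamma-v$ consists of the faces of $\Gamma$ not containing $v$, and $\mathrm{link}_\Gamma(v)=\{G\setminus\{v\}: v\in G\in\Gamma\}$. The vertex $v$ is a shedding vertex if no face of $\mathrm{link}_\Gamma(v)$ is a facet of $\Gamma-v$. The complex $\Gamma$ is vertex decomposable if it is a simplex (possibly $\{\emptyset\}$) or has a shedding vertex $v$ such that $\mathrm{link}_\Gamma(v)$ and $\Gamma-v$ are vertex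 decomposable. - $\Gamma$ is shellable if its facets can be ordered $F_1,\dots,F_t$ such that for every $1\le i<t$ the complex $\langle F_1,\dots,F_i\rangle\cap\langle F_{i+1}\rangle$ is pure of dimension $\dim F_{i+1}-1$. - $\Gamma$ is Cohen–Macaulay over a field $K$ if its Stanley–Reisner ring over $K$ is Cohen–Macaulay, and Cohen–Macaulay if this holds for every field $K$. It is sequentially Cohen–Macaulay (respectively, sequentially Cohen–Macaulay over $K$) if for every $i\le\dim\Gamma$ its pure $i$-skeleton, the complex generated by the $i$-dimensional faces of $\Gamma$, is Cohen–Macaulay (respectively, Cohen–Macaulay over $K$). The statements about sequential Cohen–Macaulayness hold both for the property over every field and for the property over each fixed field $K$. -/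

import Mathlib

universe u w

/-- The depth of a local ring: the supremum of the lengths of the regular sequences contained in
its maximal ideal. -/
noncomputable def localDepth (R : Type u) [CommRing R] [IsLocalRing R] : ℕ∞ :=
  ⨆ (rs : List R) (_ : (∀ r ∈ rs, r ∈ IsLocalRing.maximalIdeal R) ∧
    RingTheory.Sequence.IsRegular R rs), (rs.length : ℕ∞)

/-- A local ring is Cohen-Macaulay if it is Noetherian and its depth equals its Krull dimension. -/
def IsCohenMacaulayLocalRing (R : Type u) [CommRing R] [IsLocalRing R] : Prop :=
  IsNoetherianRing R ∧ (localDepth R : WithBot ℕ∞) = ringKrullDim R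

/-- A commutative ring is Cohen-Macaulay if it is Noetherian and all its localizations at maximal
ideals are Cohen-Macaulay local rings. -/
def IsCohenMacaulayRing (R : Type u) [CommRing R] : Prop :=
  IsNoetherianRing R ∧
    ∀ (m : Ideal R) [m.IsMaximal], IsCohenMacaulayLocalRing (Localization.AtPrime m)

/-- An abstract simplicial complex with vertices in `V`: a family of finite subsets of `V` which is
closed under taking subsets. The empty set is a face of every complex that has a face, the complex
`{∅}` differs from the complex without faces, and an element of `V` need not be a vertex. (Mathlib's
abstract simplicial complexes exclude the empty face, so they cannot tell these two apart.) -/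
@[ext]
structure FaceComplex (V : Type u) where
  faces : Set (Finset V)
  down_closed : ∀ F ∈ faces, ∀ G : Finset V, G ⊆ F → G ∈ faces

namespace FaceComplex

variable {V : Type u}

/-- A facet is a face that is maximal with respect to inclusion. -/
def IsFacet (Γ : FaceComplex V) (F : Finset V) : Prop :=
  F ∈ Γ.faces ∧ ∀ G ∈ Γ.faces, F ⊆ G → F = G

/-- `v` is a vertex of the complex. -/
def IsVertex (Γ : FaceComplex V) (v : V) : Prop := {v} ∈ Γ.faces

/-- A free vertex is a vertex contained in exactly one facet. -/
def IsFreeVertex (Γ : FaceComplex V) (v : V) : Prop :=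
  Γ.IsVertex v ∧ ∃! F : Finset V, Γ.IsFacet F ∧ v ∈ F

/-- The complex `⟨𝓕⟩` generated by a family of finite sets. -/
def generated (𝓕 : Set (Finset V)) : FaceComplex V where
  faces := {G | ∃ F ∈ 𝓕, G ⊆ F}
  down_closed := fun _ ⟨F, hF, hGF⟩ _ h => ⟨F, hF, h.trans hGF⟩

/-- The union `Γ + Δ` of two complexes. -/
instance : Add (FaceComplex V) where
  add Γ Δ :=
    { faces := Γ.faces ∪ Δ.faces
      down_closed := fun F hF G h =>
        hF.imp (fun hF => Γ.down_closed F hF G h) (fun hF => Δ.down_closed F hF G h) }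

/-- The intersection `Γ ∩ Δ` of two complexes. -/
instance : Inter (FaceComplex V) where
  inter Γ Δ :=
    { faces := Γ.faces ∩ Δ.faces
      down_closed := fun F hF G h =>
        ⟨Γ.down_closed F hF.1 G h, Δ.down_closed F hF.2 G h⟩ }

/-- The link of `F` in `Γ`, whose faces are the sets `G \ F` with `F ⊆ G ∈ Γ`. -/
def link [DecidableEq V] (Γ : FaceComplex V) (F : Finset V) : FaceComplex V where
  faces := {H | ∃ G ∈ Γ.faces, F ⊆ G ∧ H = G \ F}
  down_closed := by
    rintro _ ⟨G, hG, hFG, rfl⟩ H hH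
    refine ⟨H ∪ F, Γ.down_closed G hG _
      (Finset.union_subset (hH.trans Finset.sdiff_subset) hFG), Finset.subset_union_right, ?_⟩
    ext x
    have := @hH x
    simp only [Finset.mem_sdiff, Finset.mem_union] at this ⊢
    tauto

/-- The deletion `Γ - v`. -/
def deletion (Γ : FaceComplex V) (v : V) : FaceComplex V where
  faces := {F | F ∈ Γ.faces ∧ v ∉ F}
  down_closed := fun F hF G h => ⟨Γ.down_closed F hF.1 G h, fun hv => hF.2 (h hv)⟩

/-- A simplex is a complex generated by a single face (possibly the empty one). -/
def IsSimplex (Γ : FaceComplex V) : Prop := ∃ F : Finset V, Γ = generated {F}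

/-- `v` is a shedding vertex: no face of the link of `v` is a facet of `Γ - v`. -/
def IsSheddingVertex [DecidableEq V] (Γ : FaceComplex V) (v : V) : Prop :=
  Γ.IsVertex v ∧ ∀ G ∈ (Γ.link {v}).faces, ¬ (Γ.deletion v).IsFacet G

/-- Vertex decomposable (not necessarily pure) complexes. -/
inductive IsVertexDecomposable [DecidableEq V] : FaceComplex V → Prop
  | of_isSimplex (Γ : FaceComplex V) (h : Γ.IsSimplex) : IsVertexDecomposable Γ
  | of_shedding (Γ : FaceComplex V) (v : V) (hv : Γ.IsSheddingVertex v)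
      (hlink : IsVertexDecomposable (Γ.link {v}))
      (hdel : IsVertexDecomposable (Γ.deletion v)) : IsVertexDecomposable Γ

/-- The dimension `|F| - 1` of a face. -/
def faceDim (F : Finset V) : ℤ := (F.card : ℤ) - 1

/-- The complex has a facet and all its facets have dimension `d`. -/
def IsPureOfDim (Γ : FaceComplex V) (d : ℤ) : Prop :=
  (∃ F, Γ.IsFacet F) ∧ ∀ F, Γ.IsFacet F → faceDim F = d

/-- `l` is a shelling order: it lists all facets of `Γ` without repetition, and each facet `l[i]`
but the first one meets the complex generated by the preceding facets in a pure complex of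
dimension `dim l[i] - 1`. -/
def IsShellingOrder (Γ : FaceComplex V) (l : List (Finset V)) : Prop :=
  l.Nodup ∧ (∀ F, F ∈ l ↔ Γ.IsFacet F) ∧
    ∀ (i : ℕ) (hi : i < l.length), 0 < i →
      (generated {F | F ∈ l.take i} ∩ generated {l[i]}).IsPureOfDim (faceDim l[i] - 1)

/-- Shellable (not necessarily pure) complexes. -/
def IsShellable (Γ : FaceComplex V) : Prop := ∃ l : List (Finset V), Γ.IsShellingOrder l

/-- The Stanley-Reisner ideal, generated by the squarefree monomials of the non-faces. An element of
`V` that is not a vertex contributes its variable to the ideal. -/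
noncomputable def stanleyReisnerIdeal (Γ : FaceComplex V) (K : Type w) [Field K] :
    Ideal (MvPolynomial V K) :=
  Ideal.span {p | ∃ F : Finset V, F ∉ Γ.faces ∧ p = ∏ v ∈ F, MvPolynomial.X v}

/-- `Γ` is Cohen-Macaulay over `K`: its Stanley-Reisner ring over `K` is Cohen-Macaulay. -/
def IsCohenMacaulayOver (Γ : FaceComplex V) (K : Type w) [Field K] : Prop :=
  IsCohenMacaulayRing (MvPolynomial V K ⧸ Γ.stanleyReisnerIdeal K)

/-- `Γ` is Cohen-Macaulay over every field. -/
def IsCohenMacaulay (Γ : FaceComplex V) : Prop :=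
  ∀ (K : Type w) [Field K], Γ.IsCohenMacaulayOver K

/-- The pure `(n - 1)`-skeleton, generated by the faces with `n` elements. -/
def pureSkeleton (Γ : FaceComplex V) (n : ℕ) : FaceComplex V :=
  generated {F | F ∈ Γ.faces ∧ F.card = n}

/-- `Γ` is sequentially Cohen-Macaulay over `K`: all its pure skeletons of dimension at most
`dim Γ` are Cohen-Macaulay over `K`. -/
def IsSequentiallyCMOver (Γ : FaceComplex V) (K : Type w) [Field K] : Prop :=
  ∀ n : ℕ, (∃ F ∈ Γ.faces, F.card = n) → (Γ.pureSkeleton n).IsCohenMacaulayOver K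

/-- `Γ` is sequentially Cohen-Macaulay: all its pure skeletons of dimension at most `dim Γ` are
Cohen-Macaulay (over every field). -/
def IsSequentiallyCM (Γ : FaceComplex V) : Prop :=
  ∀ n : ℕ, (∃ F ∈ Γ.faces, F.card = n) → IsCohenMacaulay.{u, w} (Γ.pureSkeleton n)

end FaceComplex

/-! ### Faces, facets, links and deletions -/

namespace FaceComplex

variable {V : Type u}

/-! The facet through `a` is `E`, which misses `b`, so `{a, b}` is a new face. No facet of `Γ` lies
inside it, so the facets of `Γ + ⟨ab⟩` are those of `Γ` and `{a, b}` (`isFacet_add_iff`).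

Vertex decomposability: induct along a shedding sequence. Deleting `a` gives the same complex with
or without the edge; the link of `a` is a simplex, with the isolated point `b` added when the edge
is present. A shedding vertex other than `a`, `b` avoids `E` and `F`, so its link is unchanged and
the hypotheses survive its deletion (`isShedding_iff`, `FreePair.deletion`). In the converse, size
three rules out that `E` minus a vertex fits into the new edge.

Shellability: append `{a, b}`, which meets `Γ` in two points. Conversely, drop `{a, b}` from a
shelling. It meets a later facet in at most a point, while that intersection must be pure of
codimension one; so for `E` and `F`, of size at least three, it contributes nothing
(`generated_insert_inter`).

Sequential Cohen–Macaulayness: only the pure 1-skeleton changes, and a graph without isolated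
vertices having an edge is Cohen–Macaulay exactly when connected. Adding an edge between old
vertices keeps it connected. Conversely, the pure 2-skeleton is unchanged, connected, and contains
`a` and `b` when `E` and `F` have size at least three, so the new edge can be replaced by a path in
`Γ`. The graph criterion has two halves. If a complex is disconnected, the variables on the two
sides generate ideals with product zero and sum the irrelevant ideal, which bounds the depth by one
(`localDepth_le_one_of_mul_eq_bot`). If a graph is connected, elements of its Stanley–Reisner ring
are compatible families of polynomials on the edges, and divisibility can be checked edge by edge
and glued (`FaceConnected.exists_restrict_eq`). -/

theorem mem_add_iff {Γ Δ : FaceComplex V} {G : Finset V} :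
    G ∈ (Γ + Δ).faces ↔ G ∈ Γ.faces ∨ G ∈ Δ.faces := Iff.rfl

theorem mem_generated_singleton {S G : Finset V} :
    G ∈ (generated {S}).faces ↔ G ⊆ S := by
  simp [generated]

theorem mem_deletion {Γ : FaceComplex V} {v : V} {G : Finset V} :
    G ∈ (Γ.deletion v).faces ↔ G ∈ Γ.faces ∧ v ∉ G := Iff.rfl

theorem exists_facet [Finite V] {Γ : FaceComplex V} {G : Finset V} (hG : G ∈ Γ.faces) :
    ∃ F, Γ.IsFacet F ∧ G ⊆ F := by
  have := Fintype.ofFinite V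
  obtain ⟨F, hGF, hF⟩ := (Set.toFinite Γ.faces).exists_le_maximal hG
  exact ⟨F, ⟨hF.1, fun H hH hFH => hFH.antisymm (hF.2 hH hFH)⟩, hGF⟩

theorem mem_link_singleton [DecidableEq V] {Γ : FaceComplex V} {v : V} {H : Finset V} :
    H ∈ (Γ.link {v}).faces ↔ v ∉ H ∧ insert v H ∈ Γ.faces := by
  constructor
  · rintro ⟨G, hG, hv, rfl⟩
    rw [Finset.singleton_subset_iff] at hv
    refine ⟨by simp, ?_⟩
    rwa [Finset.sdiff_singleton_eq_erase, Finset.insert_erase hv]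
  · rintro ⟨hv, hH⟩
    exact ⟨_, hH, by simp, by
      rw [Finset.sdiff_singleton_eq_erase, Finset.erase_insert hv]⟩

theorem IsFacet.deletion {Γ : FaceComplex V} {v : V} {G : Finset V} (hG : Γ.IsFacet G)
    (hv : v ∉ G) : (Γ.deletion v).IsFacet G :=
  ⟨⟨hG.1, hv⟩, fun H hH => hG.2 H hH.1⟩

/-- If a face through `v` contains `G`, erasing `v` from it gives `G` by maximality, so `G` lies in
the link, against shedding. -/
theorem IsSheddingVertex.isFacet_of_deletion [DecidableEq V] {Γ : FaceComplex V} {v : V}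
    (hv : Γ.IsSheddingVertex v) {G : Finset V} (hG : (Γ.deletion v).IsFacet G) :
    Γ.IsFacet G := by
  refine ⟨hG.1.1, fun H hH hGH => ?_⟩
  by_cases hvH : v ∈ H
  · have hGe : G ⊆ H.erase v := Finset.subset_erase.2 ⟨hGH, hG.1.2⟩
    have := hG.2 (H.erase v) ⟨Γ.down_closed H hH _ (Finset.erase_subset _ _), by simp⟩ hGe
    refine absurd hG (hv.2 G (mem_link_singleton.2 ⟨hG.1.2, ?_⟩))
    rwa [this, Finset.insert_erase hvH]
  · exact hG.2 H ⟨hH, hvH⟩ hGH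

theorem isVertexDecomposable_generated [DecidableEq V] (S : Finset V) :
    (generated {S}).IsVertexDecomposable :=
  .of_isSimplex _ ⟨S, rfl⟩

/-- The disjoint union of a nonempty simplex and a point is vertex decomposable. -/
theorem isVertexDecomposable_generated_add_point [DecidableEq V] {S : Finset V} {b : V}
    (hS : S.Nonempty) (hb : b ∉ S) :
    (generated {S} + generated {{b}}).IsVertexDecomposable := by
  have hlink : (generated {S} + generated {{b}}).link {b} = generated {∅} := by
    ext H
    simp only [mem_link_singleton, mem_add_iff, mem_generated_singleton, Finset.subset_empty]
    constructor
    · rintro ⟨h1, h2 | h2⟩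
      · exact absurd (h2 (Finset.mem_insert_self b H)) hb
      · refine Finset.eq_empty_of_forall_notMem fun x hx => ?_
        have := h2 (Finset.mem_insert_of_mem hx)
        rw [Finset.mem_singleton] at this
        exact h1 (this ▸ hx)
    · rintro rfl
      simp
  have hdel : (generated {S} + generated {{b}}).deletion b = generated {S} := by
    ext H
    simp only [mem_deletion, mem_add_iff, mem_generated_singleton]
    constructor
    · rintro ⟨h | h, hbH⟩
      · exact h
      · rcases Finset.subset_singleton_iff.1 h with rfl | rfl
        · exact Finset.empty_subset _
        · simp at hbH
    · exact fun h => ⟨.inl h, fun h' => hb (h h')⟩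
  refine .of_shedding _ b ⟨?_, ?_⟩ ?_ ?_
  · exact .inr (mem_generated_singleton.2 subset_rfl)
  · rw [hlink, hdel]
    intro G hG hG'
    have := hG'.2 S (mem_generated_singleton.2 subset_rfl) (by
      rw [Finset.subset_empty.1 (mem_generated_singleton.1 hG)]; exact Finset.empty_subset _)
    rw [Finset.subset_empty.1 (mem_generated_singleton.1 hG)] at this
    exact hS.ne_empty this.symm
  · rw [hlink]; exact isVertexDecomposable_generated _
  · rw [hdel]; exact isVertexDecomposable_generated _

/-- `a` and `b` are free vertices lying in the distinct facets `E` and `F`, neither of which is a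
single vertex. -/
structure FreePair (Γ : FaceComplex V) (a b : V) (E F : Finset V) : Prop where
  left : Γ.IsFacet E
  right : Γ.IsFacet F
  mem_left : a ∈ E
  mem_right : b ∈ F
  eq_left : ∀ G, Γ.IsFacet G → a ∈ G → G = E
  eq_right : ∀ G, Γ.IsFacet G → b ∈ G → G = F
  ne : E ≠ F
  card_left : 2 ≤ E.card
  card_right : 2 ≤ F.card

/-! ### The effect of the new edge on facets, links and shedding vertices -/

namespace FreePair

variable {Γ : FaceComplex V} {a b : V} {E F : Finset V}

theorem symm (h : FreePair Γ a b E F) : FreePair Γ b a F E :=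
  ⟨h.right, h.left, h.mem_right, h.mem_left, h.eq_right, h.eq_left, h.ne.symm, h.card_right,
    h.card_left⟩

theorem notMem_left (h : FreePair Γ a b E F) : b ∉ E := fun hb => h.ne (h.eq_right E h.left hb)

theorem notMem_right (h : FreePair Γ a b E F) : a ∉ F := h.symm.notMem_left

theorem vertex_ne (h : FreePair Γ a b E F) : a ≠ b := fun hab =>
  h.notMem_left (hab ▸ h.mem_left)

theorem subset_left [Finite V] (h : FreePair Γ a b E F) {G : Finset V} (hG : G ∈ Γ.faces)
    (haG : a ∈ G) : G ⊆ E := by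
  obtain ⟨H, hH, hGH⟩ := exists_facet hG
  exact h.eq_left H hH (hGH haG) ▸ hGH

variable [DecidableEq V]

theorem pair_notMem [Finite V] (h : FreePair Γ a b E F) : {a, b} ∉ Γ.faces := fun hab =>
  h.notMem_left (h.subset_left hab (by simp) (by simp))

theorem card_of_isFacet (h : FreePair Γ a b E F) {G : Finset V} (hG : Γ.IsFacet G)
    (hGab : G ⊆ {a, b}) : 2 ≤ G.card := by
  by_cases haG : a ∈ G
  · exact h.eq_left G hG haG ▸ h.card_left
  by_cases hbG : b ∈ G
  · exact h.eq_right G hG hbG ▸ h.card_right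
  have : G = ∅ := Finset.eq_empty_of_forall_notMem fun x hx => by
    have := hGab hx
    simp only [Finset.mem_insert, Finset.mem_singleton] at this
    rcases this with rfl | rfl <;> contradiction
  subst this
  have := hG.2 E h.left.1 (Finset.empty_subset _)
  have h2 := h.card_left
  simp [← this] at h2

theorem not_isFacet_of_subset [Finite V] (h : FreePair Γ a b E F) {G : Finset V}
    (hGab : G ⊆ {a, b}) : ¬ Γ.IsFacet G := fun hG => by
  have h2 := h.card_of_isFacet hG hGab
  have : G = {a, b} := Finset.eq_of_subset_of_card_le hGab
    (Finset.card_le_two.trans h2)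
  exact h.pair_notMem (this ▸ hG.1)

theorem isFacet_add_iff [Finite V] (h : FreePair Γ a b E F) {G : Finset V} :
    (Γ + generated {{a, b}}).IsFacet G ↔ Γ.IsFacet G ∨ G = {a, b} := by
  constructor
  · rintro ⟨hG | hG, hmax⟩
    · exact .inl ⟨hG, fun H hH => hmax H (.inl hH)⟩
    · exact .inr (hmax _ (.inr (mem_generated_singleton.2 subset_rfl))
        (mem_generated_singleton.1 hG))
  · rintro (hG | rfl)
    · refine ⟨.inl hG.1, ?_⟩
      rintro H (hH | hH) hGH
      · exact hG.2 H hH hGH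
      · exact absurd hG (h.not_isFacet_of_subset (hGH.trans (mem_generated_singleton.1 hH)))
    · refine ⟨.inr (mem_generated_singleton.2 subset_rfl), ?_⟩
      rintro H (hH | hH) hGH
      · exact absurd (Γ.down_closed H hH _ hGH) h.pair_notMem
      · exact hGH.antisymm (mem_generated_singleton.1 hH)

/-- Without `a`, the new edge leaves only subsets of `{b}`, which lie in `F`. -/
theorem deletion_left (h : FreePair Γ a b E F) :
    (Γ + generated {{a, b}}).deletion a = Γ.deletion a := by
  ext H
  simp only [mem_deletion, mem_add_iff, mem_generated_singleton]
  refine ⟨?_, fun hH => ⟨.inl hH.1, hH.2⟩⟩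
  rintro ⟨hH | hH, haH⟩
  · exact ⟨hH, haH⟩
  · refine ⟨Γ.down_closed F h.right.1 H fun x hx => ?_, haH⟩
    have := hH hx
    simp only [Finset.mem_insert, Finset.mem_singleton] at this
    rcases this with rfl | rfl
    · contradiction
    · exact h.mem_right

theorem link_left [Finite V] (h : FreePair Γ a b E F) :
    Γ.link {a} = generated {E.erase a} := by
  ext H
  simp only [mem_link_singleton, mem_generated_singleton, Finset.subset_erase]
  constructor
  · rintro ⟨haH, hH⟩
    exact ⟨(Finset.subset_insert a H).trans (h.subset_left hH (by simp)), haH⟩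
  · rintro ⟨hHE, haH⟩
    exact ⟨haH, Γ.down_closed E h.left.1 _ (Finset.insert_subset h.mem_left hHE)⟩

theorem link_add_left [Finite V] (h : FreePair Γ a b E F) :
    (Γ + generated {{a, b}}).link {a} = generated {E.erase a} + generated {{b}} := by
  rw [← h.link_left]
  ext H
  simp only [mem_link_singleton, mem_add_iff, mem_generated_singleton, and_or_left]
  refine or_congr_right ?_
  constructor
  · rintro ⟨haH, hH⟩ x hx
    have := hH (Finset.mem_insert_of_mem hx)
    simp only [Finset.mem_insert, Finset.mem_singleton] at this ⊢
    rcases this with rfl | rfl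
    · contradiction
    · rfl
  · intro hH
    refine ⟨fun haH => h.vertex_ne (Finset.mem_singleton.1 (hH haH)), ?_⟩
    exact Finset.insert_subset_insert a hH

theorem link_of_ne {v : V} (hva : v ≠ a) (hvb : v ≠ b) :
    (Γ + generated {{a, b}}).link {v} = Γ.link {v} := by
  ext H
  simp only [mem_link_singleton, mem_add_iff, mem_generated_singleton]
  refine and_congr_right fun _ => or_iff_left fun hH => ?_
  have := hH (Finset.mem_insert_self v H)
  simp [hva, hvb] at this

theorem deletion_of_ne {v : V} (hva : v ≠ a) (hvb : v ≠ b) :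
    (Γ + generated {{a, b}}).deletion v = Γ.deletion v + generated {{a, b}} := by
  ext H
  simp only [mem_deletion, mem_add_iff, mem_generated_singleton, or_and_right]
  refine or_congr_right (and_iff_left_of_imp fun hH hv => ?_)
  have := hH hv
  simp [hva, hvb] at this

/-- The link gains only the point `b`, which is not a facet of the deletion because `F` survives
there and has at least two elements. -/
theorem isShedding_left_iff [Finite V] (h : FreePair Γ a b E F) :
    (Γ + generated {{a, b}}).IsSheddingVertex a ↔ Γ.IsSheddingVertex a := by
  have haΓ : Γ.IsVertex a :=
    Γ.down_closed E h.left.1 _ (Finset.singleton_subset_iff.2 h.mem_left)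
  rw [IsSheddingVertex, IsSheddingVertex, h.deletion_left, h.link_add_left, h.link_left]
  refine and_congr (iff_of_true (.inl haΓ) haΓ) ?_
  constructor
  · exact fun H G hG => H G (.inl hG)
  · rintro H G (hG | hG) hfac
    · exact H G hG hfac
    · have hGF : G ⊆ F := (mem_generated_singleton.1 hG).trans
        (Finset.singleton_subset_iff.2 h.mem_right)
      have := hfac.2 F ⟨h.right.1, h.notMem_right⟩ hGF
      have h1 := Finset.card_le_card (mem_generated_singleton.1 hG)
      have h2 := h.card_right
      rw [this] at h1
      simp at h1
      omega

theorem isVertexDecomposable_add_of_left [Finite V] (h : FreePair Γ a b E F)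
    (ha : Γ.IsSheddingVertex a) (hdel : (Γ.deletion a).IsVertexDecomposable) :
    (Γ + generated {{a, b}}).IsVertexDecomposable := by
  refine .of_shedding _ a (h.isShedding_left_iff.2 ha) ?_ (h.deletion_left ▸ hdel)
  rw [h.link_add_left]
  refine isVertexDecomposable_generated_add_point ?_ ?_
  · rw [← Finset.card_pos, Finset.card_erase_of_mem h.mem_left]
    have := h.card_left
    omega
  · exact fun hb => h.notMem_left (Finset.mem_of_mem_erase hb)

theorem isVertexDecomposable_of_left [Finite V] (h : FreePair Γ a b E F)
    (ha : (Γ + generated {{a, b}}).IsSheddingVertex a)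
    (hdel : ((Γ + generated {{a, b}}).deletion a).IsVertexDecomposable) :
    Γ.IsVertexDecomposable := by
  refine .of_shedding _ a (h.isShedding_left_iff.1 ha) ?_ (h.deletion_left ▸ hdel)
  rw [h.link_left]
  exact isVertexDecomposable_generated _

/-- A shedding vertex other than the free vertex `a` does not lie in the facet containing `a`. -/
theorem notMem_of_isShedding [Finite V] (h : FreePair Γ a b E F) {v : V}
    (hv : Γ.IsSheddingVertex v) (hva : v ≠ a) : v ∉ E := by
  intro hvE
  -- A facet of the deletion over `E \ {v}` is a facet of `Γ` through `a`, hence `E`, yet it misses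
  -- `v`.
  have hmem : E.erase v ∈ (Γ.deletion v).faces :=
    ⟨Γ.down_closed E h.left.1 _ (Finset.erase_subset _ _), by simp⟩
  obtain ⟨G, hG, hEG⟩ := exists_facet hmem
  have := h.eq_left G (hv.isFacet_of_deletion hG)
    (hEG (Finset.mem_erase.2 ⟨hva.symm, h.mem_left⟩))
  exact hG.1.2 (this ▸ hvE)

/-- The facet over `E \ {v}` could now also be the new edge; that would force `E \ {v} ⊆ {a}`, too
small for `|E| ≥ 3`. -/
theorem notMem_of_isShedding_add [Finite V] (h : FreePair Γ a b E F) (hE : 3 ≤ E.card) {v : V}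
    (hv : (Γ + generated {{a, b}}).IsSheddingVertex v) (hva : v ≠ a) : v ∉ E := by
  intro hvE
  have hmem : E.erase v ∈ ((Γ + generated {{a, b}}).deletion v).faces :=
    ⟨.inl (Γ.down_closed E h.left.1 _ (Finset.erase_subset _ _)), by simp⟩
  obtain ⟨G, hG, hEG⟩ := exists_facet hmem
  rcases h.isFacet_add_iff.1 (hv.isFacet_of_deletion hG) with hG' | rfl
  · have := h.eq_left G hG' (hEG (Finset.mem_erase.2 ⟨hva.symm, h.mem_left⟩))
    exact hG.1.2 (this ▸ hvE)
  · have hsub : E.erase v ⊆ {a} := fun x hx => by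
      have := hEG hx
      simp only [Finset.mem_insert, Finset.mem_singleton] at this ⊢
      rcases this with rfl | rfl
      · rfl
      · exact absurd (Finset.mem_of_mem_erase hx) h.notMem_left
    have := Finset.card_le_card hsub
    rw [Finset.card_erase_of_mem hvE, Finset.card_singleton] at this
    omega

theorem deletion [Finite V] (h : FreePair Γ a b E F) {v : V} (hvE : v ∉ E) (hvF : v ∉ F)
    (hv : Γ.IsSheddingVertex v) : FreePair (Γ.deletion v) a b E F where
  left := h.left.deletion hvE
  right := h.right.deletion hvF
  mem_left := h.mem_left
  mem_right := h.mem_right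
  eq_left G hG := h.eq_left G (hv.isFacet_of_deletion hG)
  eq_right G hG := h.eq_right G (hv.isFacet_of_deletion hG)
  ne := h.ne
  card_left := h.card_left
  card_right := h.card_right

/-- The conditions could differ only at a facet `G` of `Γ - v` inside `{a, b}`. Such a `G` lies in
`E` or `F`, so equals it by maximality, but no facet of `Γ` fits into `{a, b}`. -/
theorem isShedding_iff [Finite V] (h : FreePair Γ a b E F) {v : V} (hvE : v ∉ E)
    (hvF : v ∉ F) :
    (Γ + generated {{a, b}}).IsSheddingVertex v ↔ Γ.IsSheddingVertex v := by
  have hva : v ≠ a := fun e => hvE (e ▸ h.mem_left)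
  have hvb : v ≠ b := fun e => hvF (e ▸ h.mem_right)
  rw [IsSheddingVertex, IsSheddingVertex, link_of_ne hva hvb, deletion_of_ne hva hvb]
  refine and_congr (or_iff_left fun hv => ?_) (forall₂_congr fun G hG => not_congr ?_)
  · simpa [hva, hvb] using mem_generated_singleton.1 hv
  have hGΓ : G ∈ Γ.faces :=
    Γ.down_closed _ (mem_link_singleton.1 hG).2 _ (Finset.subset_insert _ _)
  constructor
  · exact fun hfac => ⟨⟨hGΓ, (mem_link_singleton.1 hG).1⟩, fun H hH => hfac.2 H (.inl hH)⟩
  · refine fun hfac => ⟨.inl hfac.1, ?_⟩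
    rintro H (hH | hH) hGH
    · exact hfac.2 H hH hGH
    · refine hGH.antisymm ?_
      rw [mem_generated_singleton] at hH
      have key : ∀ {D : Finset V}, Γ.IsFacet D → v ∉ D → G ⊆ D → D = G := fun hD hvD hGD =>
        (hfac.2 _ ⟨hD.1, hvD⟩ hGD).symm
      exfalso
      by_cases haG : a ∈ G
      · have := key h.left hvE (h.subset_left hGΓ haG)
        exact h.not_isFacet_of_subset (this ▸ hGH.trans hH) h.left
      · have hGF : G ⊆ F := fun x hx => by
          have := hH (hGH hx)
          simp only [Finset.mem_insert, Finset.mem_singleton] at this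
          rcases this with rfl | rfl
          · contradiction
          · exact h.mem_right
        have := key h.right hvF hGF
        exact h.not_isFacet_of_subset (this ▸ hGH.trans hH) h.right

end FreePair

/-! ### Vertex decomposability -/

theorem IsVertexDecomposable.add_edge [Finite V] [DecidableEq V] {Γ : FaceComplex V} {a b : V}
    {E F : Finset V} (hΓ : Γ.IsVertexDecomposable) (h : FreePair Γ a b E F) :
    (Γ + generated {{a, b}}).IsVertexDecomposable := by
  induction hΓ with
  | of_isSimplex Γ hs =>
    obtain ⟨S, rfl⟩ := hs
    have key : ∀ {D : Finset V}, (generated {S}).IsFacet D → D = S := fun hD =>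
      hD.2 S (mem_generated_singleton.2 subset_rfl) (mem_generated_singleton.1 hD.1)
    exact absurd ((key h.left).trans (key h.right).symm) h.ne
  | of_shedding Γ v hv hlink hdel _ ih =>
    by_cases hva : v = a
    · subst hva
      exact h.isVertexDecomposable_add_of_left hv hdel
    by_cases hvb : v = b
    · subst hvb
      rw [Finset.pair_comm]
      exact h.symm.isVertexDecomposable_add_of_left hv hdel
    have hvE := h.notMem_of_isShedding hv hva
    have hvF := h.symm.notMem_of_isShedding hv hvb
    refine .of_shedding _ v ((h.isShedding_iff hvE hvF).2 hv) ?_ ?_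
    · rwa [FreePair.link_of_ne hva hvb]
    · rw [FreePair.deletion_of_ne hva hvb]
      exact ih (h.deletion hvE hvF hv)

theorem IsVertexDecomposable.of_add_edge [Finite V] [DecidableEq V] {Γ : FaceComplex V} {a b : V}
    {E F : Finset V} (hΓ : (Γ + generated {{a, b}}).IsVertexDecomposable)
    (h : FreePair Γ a b E F) (hE : 3 ≤ E.card) (hF : 3 ≤ F.card) : Γ.IsVertexDecomposable := by
  generalize hΔ : Γ + generated {{a, b}} = Δ at hΓ
  induction hΓ generalizing Γ with
  | of_isSimplex Δ hs =>
    subst hΔ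
    obtain ⟨S, hS⟩ := hs
    have key : ∀ {D : Finset V}, Γ.IsFacet D → D = S := fun hD => by
      have hD := h.isFacet_add_iff.2 (.inl hD)
      rw [hS] at hD
      exact hD.2 S (mem_generated_singleton.2 subset_rfl) (mem_generated_singleton.1 hD.1)
    exact absurd ((key h.left).trans (key h.right).symm) h.ne
  | of_shedding Δ v hv hlink hdel _ ih =>
    subst hΔ
    by_cases hva : v = a
    · subst hva
      exact h.isVertexDecomposable_of_left hv hdel
    by_cases hvb : v = b
    · subst hvb
      rw [Finset.pair_comm] at hv hdel
      exact h.symm.isVertexDecomposable_of_left hv hdel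
    have hvE := h.notMem_of_isShedding_add hE hv hva
    have hvF := h.symm.notMem_of_isShedding_add hF (Finset.pair_comm a b ▸ hv) hvb
    have hvΓ := (h.isShedding_iff hvE hvF).1 hv
    refine .of_shedding _ v hvΓ ?_ ?_
    · rwa [FreePair.link_of_ne hva hvb] at hlink
    · exact ih (h.deletion hvE hvF hvΓ) (FreePair.deletion_of_ne hva hvb).symm

/-! ### Shellability -/

namespace FreePair

variable {Γ : FaceComplex V} {a b : V} {E F : Finset V} [DecidableEq V] [Finite V]

theorem isPureOfDim_inter_edge (h : FreePair Γ a b E F) :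
    (Γ ∩ generated {{a, b}}).IsPureOfDim (faceDim ({a, b} : Finset V) - 1) := by
  have ha : ({a} : Finset V) ∈ Γ.faces :=
    Γ.down_closed E h.left.1 _ (Finset.singleton_subset_iff.2 h.mem_left)
  have hcard : ∀ H ∈ (Γ ∩ generated {{a, b}}).faces, H.card ≤ 1 := by
    rintro H ⟨hH, hHab⟩
    by_contra hlt
    have : H = {a, b} := Finset.eq_of_subset_of_card_le (mem_generated_singleton.1 hHab)
      (Finset.card_le_two.trans (by omega))
    exact h.pair_notMem (this ▸ hH)
  have hmem : ({a} : Finset V) ∈ (Γ ∩ generated {{a, b}}).faces :=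
    ⟨ha, mem_generated_singleton.2 (by simp)⟩
  refine ⟨⟨{a}, hmem, fun G hG haG => ?_⟩, fun G hG => ?_⟩
  · exact Finset.eq_of_subset_of_card_le haG (by simpa using hcard G hG)
  · have h1 := hcard G hG.1
    have h2 : G.card ≠ 0 := fun h0 => by
      rw [Finset.card_eq_zero] at h0
      have := hG.2 _ hmem (by simp [h0])
      simp [h0] at this
    simp only [faceDim, Finset.card_pair h.vertex_ne]
    omega

/-- By purity `H` extends to a facet of the intersection with `|E| - 1 ≥ 2` elements; since `b ∉ E`,
that facet cannot come from the edge. -/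
theorem exists_subset_of_isPureOfDim (h : FreePair Γ a b E F) (hE : 3 ≤ E.card)
    {S : Set (Finset V)}
    (hp : (generated (insert {a, b} S) ∩ generated {E}).IsPureOfDim (faceDim E - 1))
    {H : Finset V} (hH : H ∈ (generated (insert {a, b} S) ∩ generated {E}).faces) :
    H ∈ (generated S).faces := by
  obtain ⟨H', hH', hHH'⟩ := exists_facet hH
  have hcard := hp.2 H' hH'
  obtain ⟨D, rfl | hD, hH'D⟩ := hH'.1.1
  · have hsub : H' ⊆ {a} := fun x hx => by
      have := hH'D hx
      simp only [Finset.mem_insert, Finset.mem_singleton] at this ⊢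
      rcases this with rfl | rfl
      · rfl
      · exact absurd (mem_generated_singleton.1 hH'.1.2 hx) h.notMem_left
    have := Finset.card_le_card hsub
    rw [Finset.card_singleton] at this
    simp only [faceDim] at hcard
    omega
  · exact ⟨D, hD, hHH'.trans hH'D⟩

theorem generated_insert_inter (h : FreePair Γ a b E F) (hE : 3 ≤ E.card) (hF : 3 ≤ F.card)
    {S : Set (Finset V)} (hS : S.Nonempty) {G : Finset V} (hG : Γ.IsFacet G)
    (hp : (generated (insert {a, b} S) ∩ generated {G}).IsPureOfDim (faceDim G - 1)) :
    generated (insert {a, b} S) ∩ generated {G} = generated S ∩ generated {G} := by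
  ext H
  constructor
  · intro hH
    refine ⟨?_, hH.2⟩
    have hHG := mem_generated_singleton.1 hH.2
    by_cases haH : a ∈ H
    · obtain rfl := h.eq_left G hG (hHG haH)
      exact h.exists_subset_of_isPureOfDim hE hp hH
    by_cases hbH : b ∈ H
    · obtain rfl := h.eq_right G hG (hHG hbH)
      rw [Finset.pair_comm] at hp hH
      exact h.symm.exists_subset_of_isPureOfDim hF hp hH
    obtain ⟨D, rfl | hD, hHD⟩ := hH.1
    -- Only the empty face is left here, and any member of `S` contains it.
    · obtain ⟨D, hD⟩ := hS
      refine ⟨D, hD, fun x hx => ?_⟩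
      have := hHD hx
      simp only [Finset.mem_insert, Finset.mem_singleton] at this
      rcases this with rfl | rfl <;> contradiction
    · exact ⟨D, hD, hHD⟩
  · rintro ⟨⟨D, hD, hHD⟩, hHG⟩
    exact ⟨⟨D, .inr hD, hHD⟩, hHG⟩

end FreePair

theorem IsShellable.add_edge [Finite V] [DecidableEq V] {Γ : FaceComplex V} {a b : V}
    {E F : Finset V} (hΓ : Γ.IsShellable) (h : FreePair Γ a b E F) :
    (Γ + generated {{a, b}}).IsShellable := by
  obtain ⟨l, hnd, hl, hsh⟩ := hΓ
  refine ⟨l ++ [{a, b}], ?_, fun G => ?_, fun i hi hi0 => ?_⟩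
  · rw [List.nodup_append]
    refine ⟨hnd, List.nodup_singleton _, ?_⟩
    rintro G hG _ hG' rfl
    rw [List.mem_singleton] at hG'
    exact h.pair_notMem (hG' ▸ ((hl G).1 hG).1)
  · rw [h.isFacet_add_iff, ← hl]
    simp
  · by_cases hil : i < l.length
    · rw [List.take_append_of_le_length hil.le, List.getElem_append_left hil]
      exact hsh i hil hi0
    · obtain rfl : i = l.length := by simp at hi; omega
      rw [List.take_left', List.getElem_concat_length]
      · have : generated {G | G ∈ l} ∩ generated {{a, b}} = Γ ∩ generated {{a, b}} := by
          ext H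
          refine and_congr_left fun _ => ?_
          constructor
          · rintro ⟨D, hD, hHD⟩
            exact Γ.down_closed D ((hl D).1 hD).1 H hHD
          · intro hH
            obtain ⟨D, hD, hHD⟩ := exists_facet hH
            exact ⟨D, (hl D).2 hD, hHD⟩
        rw [this]
        exact h.isPureOfDim_inter_edge
      all_goals rfl

theorem IsShellable.of_add_edge [Finite V] [DecidableEq V] {Γ : FaceComplex V} {a b : V}
    {E F : Finset V} (hΓ : (Γ + generated {{a, b}}).IsShellable)
    (h : FreePair Γ a b E F) (hE : 3 ≤ E.card) (hF : 3 ≤ F.card) : Γ.IsShellable := by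
  obtain ⟨l, hnd, hl, hsh⟩ := hΓ
  obtain ⟨l₁, l₂, rfl⟩ := List.append_of_mem ((hl {a, b}).2 (h.isFacet_add_iff.2 (.inr rfl)))
  rw [List.nodup_middle] at hnd
  rw [List.nodup_cons] at hnd
  have hl' : ∀ G, G ∈ l₁ ++ l₂ ↔ Γ.IsFacet G := fun G => by
    have := hl G
    rw [h.isFacet_add_iff, (List.perm_middle).mem_iff, List.mem_cons] at this
    constructor
    · intro hG
      rcases this.1 (.inr hG) with h' | rfl
      · exact h'
      · exact absurd hG hnd.1
    · intro hG
      rcases this.2 (.inl hG) with rfl | h'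
      · exact absurd hG.1 h.pair_notMem
      · exact h'
  refine ⟨l₁ ++ l₂, hnd.2, hl', fun i hi hi0 => ?_⟩
  by_cases hil : i < l₁.length
  · have := hsh i (by simp; omega) hi0
    rw [List.take_append_of_le_length hil.le, List.getElem_append_left hil] at this ⊢
    exact this
  · obtain ⟨k, rfl⟩ := Nat.exists_eq_add_of_le (not_lt.1 hil)
    -- Past the removed edge, positions in the original list are shifted by one.
    have := hsh (l₁.length + k + 1) (by simp at hi ⊢; omega) (by omega)
    have hget : (l₁ ++ {a, b} :: l₂)[l₁.length + k + 1]'(by simp at hi ⊢; omega) =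
        (l₁ ++ l₂)[l₁.length + k] := by
      rw [List.getElem_append_right (by omega), List.getElem_append_right (by omega)]
      simp [add_assoc]
    have hset : {G | G ∈ (l₁ ++ {a, b} :: l₂).take (l₁.length + k + 1)} =
        insert {a, b} {G | G ∈ (l₁ ++ l₂).take (l₁.length + k)} := by
      ext G
      simp only [add_assoc, List.take_length_add_append, List.take_succ_cons, List.mem_append,
        List.mem_cons, Set.mem_ofPred_eq, Set.mem_insert_iff]
      tauto
    rw [hget, hset] at this
    rw [← h.generated_insert_inter hE hF ?_ ((hl' _).1 (List.getElem_mem hi)) this]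
    · exact this
    · refine ⟨(l₁ ++ l₂)[0], ?_⟩
      rw [Set.mem_ofPred_eq, List.mem_take_iff_getElem]
      exact ⟨0, by simp at hi ⊢; omega, rfl⟩

end FaceComplex

/-! ### Cohen–Macaulay complexes of positive dimension are connected -/

open Pointwise in
/-- If the maximal ideal of a local ring is the sum of two nonzero ideals with product zero, the
ring has depth at most one. -/
theorem localDepth_le_one_of_mul_eq_bot {R : Type u} [CommRing R] [IsLocalRing R] {I J : Ideal R}
    (hsup : IsLocalRing.maximalIdeal R ≤ I ⊔ J) (hmul : I * J = ⊥) (hI : I ≠ ⊥) (hJ : J ≠ ⊥) :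
    localDepth R ≤ 1 := by
  refine iSup₂_le fun rs hrs => ?_
  obtain ⟨hmem, hreg⟩ := hrs
  match rs, hmem, hreg with
  | [], _, _ => simp
  | [f], _, _ => simp
  | f :: g :: l, hmem, hreg =>
    exfalso
    have hIJ : ∀ x ∈ I, ∀ y ∈ J, x * y = 0 := fun x hx y hy => by
      have := Ideal.mul_mem_mul hx hy
      rwa [hmul] at this
    rw [RingTheory.Sequence.isRegular_cons_iff, RingTheory.Sequence.isRegular_cons_iff] at hreg
    obtain ⟨hf, hg, -⟩ := hreg
    rw [isSMulRegular_iff_right_eq_zero_of_smul] at hf hg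
    obtain ⟨f₁, hf₁, f₂, hf₂, rfl⟩ := Submodule.mem_sup.1 (hsup (hmem f (by simp)))
    obtain ⟨g₁, hg₁, g₂, hg₂, rfl⟩ := Submodule.mem_sup.1 (hsup (hmem g (by simp)))
    -- Cross products vanish, so `g f₁ = g₁ f₁ = f g₁`, and `g` is regular modulo `f`.
    have h1 : f₁ ∈ (f₁ + f₂) • (⊤ : Submodule R R) := by
      rw [← Submodule.Quotient.mk_eq_zero]
      refine hg _ ?_
      rw [← Submodule.Quotient.mk_smul, Submodule.Quotient.mk_eq_zero,
        Submodule.mem_smul_pointwise_iff_exists]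
      refine ⟨g₁, trivial, ?_⟩
      simp only [smul_eq_mul]
      linear_combination hIJ g₁ hg₁ f₂ hf₂ - hIJ f₁ hf₁ g₂ hg₂
    obtain ⟨h, -, hh⟩ := (Submodule.mem_smul_pointwise_iff_exists _ _ _).1 h1
    rw [smul_eq_mul] at hh
    -- This element equals `f₂ * h`, so it lies in both `I` and `J` and is killed by `f`.
    have hz : f₁ * (1 - h) = 0 := by
      refine hf _ ?_
      rw [smul_eq_mul]
      have e : f₁ * (1 - h) = f₂ * h := by linear_combination -hh
      linear_combination f₁ * e + (1 - h + h) * hIJ f₁ hf₁ f₂ hf₂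
    -- Either way one component of `f` vanishes, so `f` lies in one ideal and kills the other, which
    -- is nonzero.
    rcases IsLocalRing.isUnit_or_isUnit_one_sub_self h with hu | hu
    · have hz2 : f₂ * h = 0 := by linear_combination hh + hz
      rw [hu.mul_left_eq_zero] at hz2
      subst hz2
      obtain ⟨y, hy, hy0⟩ := Submodule.exists_mem_ne_zero_of_ne_bot hJ
      exact hy0 (hf y (by simpa using hIJ f₁ hf₁ y hy))
    · rw [hu.mul_left_eq_zero] at hz
      subst hz
      obtain ⟨y, hy, hy0⟩ := Submodule.exists_mem_ne_zero_of_ne_bot hI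
      exact hy0 (hf y (by simpa [mul_comm] using hIJ y hy f₂ hf₂))

namespace FaceComplex

open MvPolynomial

variable {V : Type u} {Γ : FaceComplex V} {K : Type w} [Field K]

/-- The ideal is monomial, and the squarefree monomial of `F` divides that of exponent `d` exactly
when `F ⊆ d.support`. -/
theorem mem_stanleyReisnerIdeal {p : MvPolynomial V K} :
    p ∈ Γ.stanleyReisnerIdeal K ↔ ∀ d ∈ p.support, d.support ∉ Γ.faces := by
  classical
  have hgen : {p : MvPolynomial V K | ∃ F : Finset V, F ∉ Γ.faces ∧ p = ∏ v ∈ F, X v} =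
      (fun s => monomial s (1 : K)) '' ((fun F : Finset V => ∑ v ∈ F, Finsupp.single v 1) ''
        {F | F ∉ Γ.faces}) := by
    ext p
    simp only [Set.mem_ofPred_eq, Set.image_image, Set.mem_image]
    refine exists_congr fun F => and_congr_right fun _ => ?_
    rw [eq_comm, monomial_sum_one]
    rfl
  have hle : ∀ (F : Finset V) (d : V →₀ ℕ), ∑ v ∈ F, Finsupp.single v 1 ≤ d ↔ F ⊆ d.support := by
    intro F d
    have hval : ∀ x, (∑ v ∈ F, Finsupp.single v 1 : V →₀ ℕ) x = if x ∈ F then 1 else 0 := by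
      intro x
      simp [Finsupp.finsetSum_apply, Finsupp.single_apply]
    constructor
    · intro h x hx
      have := h x
      rw [hval, if_pos hx] at this
      exact Finsupp.mem_support_iff.2 (by omega)
    · intro h x
      rw [hval]
      split_ifs with hx
      · exact Nat.one_le_iff_ne_zero.2 (Finsupp.mem_support_iff.1 (h hx))
      · exact Nat.zero_le _
  rw [stanleyReisnerIdeal, hgen, mem_ideal_span_monomial_image]
  refine forall₂_congr fun d _ => ?_
  simp only [Set.mem_image, Set.mem_ofPred_eq, exists_exists_and_eq_and, hle]
  exact ⟨fun ⟨F, hF, hFd⟩ hd => hF (Γ.down_closed _ hd F hFd), fun hd => ⟨_, hd, subset_rfl⟩⟩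

variable [DecidableEq V]

/-- The endomorphism of the polynomial ring which sends the variables outside `S` to zero. -/
noncomputable def faceEval (K : Type w) [Field K] (S : Finset V) :
    MvPolynomial V K →ₐ[K] MvPolynomial V K :=
  aeval fun v => if v ∈ S then X v else 0

theorem faceEval_monomial (S : Finset V) (d : V →₀ ℕ) (c : K) :
    faceEval K S (monomial d c) = if d.support ⊆ S then monomial d c else 0 := by
  rw [faceEval, aeval_monomial]
  split_ifs with h
  · rw [monomial_eq, algebraMap_eq]
    congr 1
    exact Finsupp.prod_congr fun v hv => by rw [if_pos (h hv)]
  · obtain ⟨v, hv, hvS⟩ := Finset.not_subset.1 h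
    have : (d.prod fun i k => (if i ∈ S then (X i : MvPolynomial V K) else 0) ^ k) = 0 :=
      Finset.prod_eq_zero hv (by simp [hvS, Finsupp.mem_support_iff.1 hv])
    rw [this, mul_zero]

theorem coeff_faceEval (S : Finset V) (d : V →₀ ℕ) (p : MvPolynomial V K) :
    coeff d (faceEval K S p) = if d.support ⊆ S then coeff d p else 0 := by
  induction p using MvPolynomial.induction_on' with
  | monomial e c =>
    rw [faceEval_monomial]
    by_cases hed : e = d
    · subst hed
      split_ifs <;> simp
    · split_ifs <;> simp [coeff_monomial, hed]
  | add p q hp hq =>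
    rw [map_add, coeff_add, hp, hq]
    split_ifs <;> simp

theorem faceEval_faceEval (S T : Finset V) (p : MvPolynomial V K) :
    faceEval K S (faceEval K T p) = faceEval K (S ∩ T) p := by
  ext d
  simp only [coeff_faceEval, Finset.subset_inter_iff]
  split_ifs <;> tauto

theorem faceEval_aeval_X {S : Finset V} {v : V} (hv : v ∈ S) (q : Polynomial K) :
    faceEval K S (Polynomial.aeval (X v) q) = Polynomial.aeval (X v) q := by
  rw [← Polynomial.aeval_algHom_apply]
  simp [faceEval, hv]

theorem faceEval_eq_zero_of_mem {S : Finset V} (hS : S ∈ Γ.faces) {p : MvPolynomial V K}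
    (hp : p ∈ Γ.stanleyReisnerIdeal K) : faceEval K S p = 0 := by
  ext d
  rw [coeff_faceEval, coeff_zero]
  split_ifs with h
  · by_contra hd
    exact mem_stanleyReisnerIdeal.1 hp d (mem_support_iff.2 hd) (Γ.down_closed S hS _ h)
  · rfl

/-- The Stanley-Reisner ring. -/
abbrev StanleyReisnerRing (Γ : FaceComplex V) (K : Type w) [Field K] : Type max u w :=
  MvPolynomial V K ⧸ Γ.stanleyReisnerIdeal K

/-- The restriction of the elements of the Stanley-Reisner ring to a face. -/
noncomputable def restrict (K : Type w) [Field K] {S : Finset V} (hS : S ∈ Γ.faces) :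
    Γ.StanleyReisnerRing K →ₐ[K] MvPolynomial V K :=
  Ideal.Quotient.liftₐ _ (faceEval K S) fun _ => faceEval_eq_zero_of_mem hS

/-- The image of a variable in the Stanley-Reisner ring. -/
noncomputable def srVar (Γ : FaceComplex V) (K : Type w) [Field K] (v : V) :
    Γ.StanleyReisnerRing K :=
  Ideal.Quotient.mk _ (X v)

theorem restrict_mk {S : Finset V} (hS : S ∈ Γ.faces) (p : MvPolynomial V K) :
    restrict K hS (Ideal.Quotient.mk _ p) = faceEval K S p := rfl

theorem faceEval_restrict {S T : Finset V} (hS : S ∈ Γ.faces) (hT : T ∈ Γ.faces) (h : S ⊆ T)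
    (p : Γ.StanleyReisnerRing K) : faceEval K S (restrict K hT p) = restrict K hS p := by
  obtain ⟨p, rfl⟩ := Ideal.Quotient.mk_surjective p
  rw [restrict_mk, restrict_mk, faceEval_faceEval, Finset.inter_eq_left.2 h]

theorem restrict_aeval_srVar {S : Finset V} (hS : S ∈ Γ.faces) {v : V} (hv : v ∈ S)
    (q : Polynomial K) :
    restrict K hS (Polynomial.aeval (Γ.srVar K v) q) = Polynomial.aeval (X v) q := by
  rw [← Polynomial.aeval_algHom_apply, srVar, restrict_mk]
  simp [faceEval, hv]

theorem restrict_srVar {S : Finset V} (hS : S ∈ Γ.faces) (v : V) :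
    restrict K hS (Γ.srVar K v) = if v ∈ S then X v else 0 := by
  rw [srVar, restrict_mk]
  simp [faceEval]

theorem srVar_mul_srVar {v w : V} (h : {v, w} ∉ Γ.faces) :
    Γ.srVar K v * Γ.srVar K w = 0 := by
  rw [srVar, srVar, ← map_mul, Ideal.Quotient.eq_zero_iff_mem, mem_stanleyReisnerIdeal]
  intro d hd hdΓ
  refine h (Γ.down_closed _ hdΓ _ ?_)
  rw [X, X, monomial_mul] at hd
  have := Finset.mem_singleton.1 (support_monomial_subset hd)
  subst this
  intro x hx
  simp only [Finset.mem_insert, Finset.mem_singleton] at hx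
  rw [Finsupp.mem_support_iff]
  rcases hx with rfl | rfl <;> simp

/-- The elements of the Stanley-Reisner ring with zero constant term are the linear combinations
of the variables. -/
theorem ker_restrict_empty_le_span (h : ∅ ∈ Γ.faces) :
    RingHom.ker (restrict K h) ≤ Ideal.span (Set.range (Γ.srVar K)) := by
  intro p hp
  obtain ⟨p, rfl⟩ := Ideal.Quotient.mk_surjective p
  rw [RingHom.mem_ker, restrict_mk] at hp
  have hX : p ∈ Ideal.span (X '' (Set.univ : Set V)) := by
    rw [mem_ideal_span_X_image]
    intro d hd
    by_contra! hd0
    have : d = 0 := by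
      ext i
      exact hd0 i trivial
    subst this
    have := congrArg (coeff 0) hp
    rw [coeff_faceEval] at this
    simp at this hd
    exact hd this
  have := Ideal.mem_map_of_mem (Ideal.Quotient.mk (Γ.stanleyReisnerIdeal K)) hX
  rw [Ideal.map_span, Set.image_univ, ← Set.range_comp] at this
  exact this

/-- Restriction to the empty face is the constant term, a surjection onto `K`. -/
theorem isMaximal_ker_restrict_empty (h : ∅ ∈ Γ.faces) :
    (RingHom.ker (restrict K h)).IsMaximal := by
  have hker : RingHom.ker (restrict K h) =
      RingHom.ker ((constantCoeff (σ := V) (R := K)).comp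
        (restrict K h : Γ.StanleyReisnerRing K →+* MvPolynomial V K)) := by
    ext p
    obtain ⟨p, rfl⟩ := Ideal.Quotient.mk_surjective p
    simp only [RingHom.mem_ker, RingHom.comp_apply, RingHom.coe_coe, restrict_mk]
    constructor
    · intro h; rw [h, map_zero]
    · intro h
      ext d
      rw [coeff_faceEval, coeff_zero]
      split_ifs with hd
      · have hd0 : d = 0 := by simpa using hd
        subst hd0
        rw [constantCoeff_eq, coeff_faceEval] at h
        simpa using h
      · rfl
  rw [hker]
  refine RingHom.ker_isMaximal_of_surjective _ fun c => ?_
  refine ⟨algebraMap K _ c, ?_⟩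
  rw [RingHom.comp_apply, RingHom.coe_coe, AlgHom.commutes, algebraMap_eq, constantCoeff_C]

theorem ker_restrict_lt {S T : Finset V} (hS : S ∈ Γ.faces) (hT : T ∈ Γ.faces) (h : S ⊂ T) :
    RingHom.ker (restrict K hT) < RingHom.ker (restrict K hS) := by
  obtain ⟨v, hvT, hvS⟩ := Finset.exists_of_ssubset h
  have hsub := h.1
  refine lt_of_le_of_ne (fun p hp => ?_) fun heq => ?_
  · rw [RingHom.mem_ker] at hp ⊢
    rw [← faceEval_restrict hS hT hsub, hp, map_zero]
  · have : Γ.srVar K v ∈ RingHom.ker (restrict K hT) := by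
      rw [heq, RingHom.mem_ker, restrict_srVar, if_neg hvS]
    rw [RingHom.mem_ker, restrict_srVar, if_pos hvT] at this
    exact X_ne_zero v this

/-- A complex is connected if a set closed under adjacency which contains one vertex contains all
of them. -/
def FaceConnected (Γ : FaceComplex V) : Prop :=
  ∀ S : Set V, (∀ x y, {x, y} ∈ Γ.faces → x ∈ S → y ∈ S) →
    ∀ x y, Γ.IsVertex x → Γ.IsVertex y → x ∈ S → y ∈ S

/-- An element killing the variable restricts to zero on `{v}`, a polynomial ring being a domain, so
it has zero constant term and is not a denominator. -/
theorem algebraMap_srVar_ne_zero (h : ∅ ∈ Γ.faces) [(RingHom.ker (restrict K h)).IsPrime] {v : V}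
    (hv : Γ.IsVertex v) :
    algebraMap _ (Localization.AtPrime (RingHom.ker (restrict K h))) (Γ.srVar K v) ≠ 0 := by
  intro h0
  rw [IsLocalization.map_eq_zero_iff (RingHom.ker (restrict K h)).primeCompl] at h0
  have hv : {v} ∈ Γ.faces := hv
  obtain ⟨s, hs⟩ := h0
  have := congrArg (restrict K hv) hs
  rw [map_mul, map_zero, restrict_srVar, if_pos (Finset.mem_singleton_self v),
    mul_eq_zero_iff_right (X_ne_zero v)] at this
  refine s.2 ?_
  rw [SetLike.mem_coe, RingHom.mem_ker, ← faceEval_restrict h hv (Finset.empty_subset _), this,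
    map_zero]

/-- A complex of positive dimension which is Cohen-Macaulay over a field is connected. -/
theorem IsCohenMacaulayOver.faceConnected (hΓ : Γ.IsCohenMacaulayOver K)
    (hdim : ∃ G ∈ Γ.faces, 2 ≤ G.card) : Γ.FaceConnected := by
  intro S hS x y hx hy hxS
  by_contra hyS
  obtain ⟨G, hG, hG2⟩ := hdim
  have h0 : ∅ ∈ Γ.faces := Γ.down_closed G hG _ (Finset.empty_subset _)
  have hmax := isMaximal_ker_restrict_empty (K := K) h0
  have hCM := hΓ.2 (RingHom.ker (restrict K h0))
  set m := RingHom.ker (restrict K h0) with hm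
  let I : Set V → Ideal (Γ.StanleyReisnerRing K) := fun T => Ideal.span (Γ.srVar K '' T)
  let φ := algebraMap (Γ.StanleyReisnerRing K) (Localization.AtPrime m)
  have hne : ∀ T : Set V, ∀ v ∈ T, Γ.IsVertex v → (I T).map φ ≠ ⊥ := by
    intro T v hvT hv hbot
    have := Ideal.mem_map_of_mem φ (Ideal.subset_span (Set.mem_image_of_mem (Γ.srVar K) hvT) :
      Γ.srVar K v ∈ I T)
    rw [hbot, Ideal.mem_bot] at this
    exact algebraMap_srVar_ne_zero h0 hv this
  have hdepth : localDepth (Localization.AtPrime m) ≤ 1 := by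
    refine localDepth_le_one_of_mul_eq_bot (I := (I S).map φ) (J := (I Sᶜ).map φ) ?_ ?_
      (hne S x hxS hx) (hne Sᶜ y hyS hy)
    · rw [← Localization.AtPrime.map_eq_maximalIdeal, ← Ideal.map_sup]
      refine Ideal.map_mono ((ker_restrict_empty_le_span h0).trans ?_)
      rw [Ideal.span_le]
      rintro _ ⟨v, rfl⟩
      by_cases hv : v ∈ S
      · exact Ideal.mem_sup_left (Ideal.subset_span ⟨v, hv, rfl⟩)
      · exact Ideal.mem_sup_right (Ideal.subset_span ⟨v, hv, rfl⟩)
    · rw [← Ideal.map_mul, Ideal.span_mul_span', eq_bot_iff, ← Ideal.map_bot (f := φ)]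
      refine Ideal.map_mono (Ideal.span_le.2 ?_)
      rintro _ ⟨_, ⟨v, hv, rfl⟩, _, ⟨w, hw, rfl⟩, rfl⟩
      exact srVar_mul_srVar fun hvw => hw (hS v w hvw hv)
  -- The faces `∅ ⊂ {v} ⊂ G` give a chain of three primes ending in `m`.
  have hheight : (2 : ℕ∞) ≤ m.height := by
    obtain ⟨v, hv⟩ := Finset.card_pos.1 (by omega : 0 < G.card)
    have hvΓ : {v} ∈ Γ.faces := Γ.down_closed G hG _ (Finset.singleton_subset_iff.2 hv)
    have hlt1 : RingHom.ker (restrict K hG) < RingHom.ker (restrict K hvΓ) := by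
      refine ker_restrict_lt _ _ ⟨Finset.singleton_subset_iff.2 hv, fun h => ?_⟩
      have := Finset.card_le_card h
      simp at this
      omega
    have hlt2 : RingHom.ker (restrict K hvΓ) < m :=
      ker_restrict_lt _ _ (Finset.empty_ssubset.2 (Finset.singleton_nonempty v))
    have := RingHom.ker_isPrime (restrict K hG)
    have := RingHom.ker_isPrime (restrict K hvΓ)
    have e1 := Ideal.height_add_one_le_of_lt_of_isPrime hlt1
    have e2 := Ideal.height_add_one_le_of_lt_of_isPrime hlt2
    calc (2 : ℕ∞) = 0 + 1 + 1 := by norm_num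
      _ ≤ (RingHom.ker (restrict K hG)).height + 1 + 1 := by gcongr; exact zero_le
      _ ≤ _ := (add_le_add_left e1 1).trans e2
  have heq := hCM.2
  rw [IsLocalization.AtPrime.ringKrullDim_eq_height m, WithBot.coe_inj] at heq
  rw [← heq] at hheight
  have := hheight.trans hdepth
  norm_num at this

end FaceComplex

/-! ### Connected graphs are Cohen–Macaulay -/

/-- Every element of a finitely generated algebra over a field is algebraic modulo a maximal
ideal. -/
theorem exists_aeval_mem_of_isMaximal (K : Type w) [Field K] {A : Type u} [CommRing A] [Algebra K A]
    [Algebra.FiniteType K A] (m : Ideal A) [m.IsMaximal] (x : A) :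
    ∃ q : Polynomial K, q ≠ 0 ∧ Polynomial.aeval x q ∈ m := by
  let := Ideal.Quotient.field m
  have := finite_of_finite_type_of_isJacobsonRing K (A ⧸ m)
  obtain ⟨q, hq, hqx⟩ := Algebra.IsAlgebraic.isAlgebraic (R := K) (Ideal.Quotient.mkₐ K m x)
  refine ⟨q, hq, ?_⟩
  rw [Polynomial.aeval_algHom_apply] at hqx
  exact Ideal.Quotient.eq_zero_iff_mem.1 hqx

namespace MvPolynomial

variable {V : Type u} {K : Type w} [Field K]

theorem degreeOf_le_of_dvd {p q : MvPolynomial V K} (h : p ∣ q) (hq : q ≠ 0) (v : V) :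
    p.degreeOf v ≤ q.degreeOf v := by
  obtain ⟨r, rfl⟩ := h
  rw [degreeOf_mul_eq (left_ne_zero_of_mul hq) (right_ne_zero_of_mul hq)]
  exact Nat.le_add_right _ _

theorem aeval_X_ne_zero {q : Polynomial K} (hq : q ≠ 0) (v : V) :
    Polynomial.aeval (X v : MvPolynomial V K) q ≠ 0 := fun h =>
  transcendental_X K v ⟨q, hq, h⟩

theorem degreeOf_aeval_X_of_ne (q : Polynomial K) {v w : V} (h : w ≠ v) :
    (Polynomial.aeval (X v : MvPolynomial V K) q).degreeOf w = 0 := by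
  by_contra hne
  have hmem : Polynomial.aeval (X v : MvPolynomial V K) q ∈ supported K {v} := by
    rw [supported, Set.image_singleton]
    exact Polynomial.aeval_mem_adjoin_singleton K _
  rw [mem_supported] at hmem
  have hw : w ∈ (Polynomial.aeval (X v : MvPolynomial V K) q).vars := by
    classical
    rw [vars_def, Multiset.mem_toFinset]
    rw [degreeOf_def] at hne
    exact Multiset.count_ne_zero.1 hne
  exact h (hmem hw)

/-- A common divisor has degree zero in every variable, so it is a nonzero constant. -/
theorem isRelPrime_aeval_X {p q : Polynomial K} (hp : p ≠ 0) (hq : q ≠ 0) {v w : V} (h : v ≠ w) :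
    IsRelPrime (Polynomial.aeval (X v : MvPolynomial V K) p) (Polynomial.aeval (X w) q) := by
  intro d hdp hdq
  have hdeg : ∀ x, d.degreeOf x = 0 := by
    intro x
    by_cases hx : x = v
    · subst hx
      exact Nat.le_zero.1 ((degreeOf_le_of_dvd hdq (aeval_X_ne_zero hq w) x).trans_eq
        (degreeOf_aeval_X_of_ne q h))
    · exact Nat.le_zero.1 ((degreeOf_le_of_dvd hdp (aeval_X_ne_zero hp v) x).trans_eq
        (degreeOf_aeval_X_of_ne p hx))
  have hd0 : d ≠ 0 := ne_zero_of_dvd_ne_zero (aeval_X_ne_zero hp v) hdp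
  have hcoeff : ∀ i ≠ 0, coeff i d = 0 := by
    intro i hi
    by_contra hc
    refine hi ?_
    ext x
    exact Nat.le_zero.1 ((monomial_le_degreeOf x (mem_support_iff.2 hc)).trans_eq (hdeg x))
  rw [isUnit_iff]
  refine ⟨isUnit_iff_ne_zero.2 fun h0 => hd0 ?_, fun i hi => ?_⟩
  · ext i
    by_cases hi : i = 0
    · rw [hi, h0, coeff_zero]
    · rw [hcoeff i hi, coeff_zero]
  · rw [hcoeff i hi]
    exact IsNilpotent.zero

end MvPolynomial

theorem dvd_of_dvd_mul_of_isRelPrime {R : Type u} [CommRing R] [IsDomain R] [DecompositionMonoid R]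
    {f u α β : R} (hf : f ≠ 0) (h : IsRelPrime α β) (hα0 : α ≠ 0) (hα : f ∣ α * u)
    (hβ : f ∣ β * u) : f ∣ u := by
  obtain ⟨c, hc⟩ := hα
  obtain ⟨d, hd⟩ := hβ
  have : β * c = α * d := mul_left_cancel₀ hf (by linear_combination α * hd - β * hc)
  obtain ⟨c', rfl⟩ := h.dvd_of_dvd_mul_left ⟨d, this⟩
  exact ⟨c', mul_left_cancel₀ hα0 (by linear_combination hc)⟩

open Pointwise in
/-- Let `m` be a maximal ideal of a Noetherian ring `R` and `f ∈ m` a nonzerodivisor such that no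
nonzero element of `R / f` is annihilated by `m`. Then `f` extends to a regular sequence of length
two in `m`. -/
theorem exists_isWeaklyRegular_pair {R : Type u} [CommRing R] [IsNoetherianRing R] (m : Ideal R)
    [m.IsMaximal] {f : R} (hf : ∀ x, f * x = 0 → x = 0)
    (h : ∀ u, (∀ r ∈ m, f ∣ r * u) → f ∣ u) :
    ∃ g ∈ m, RingTheory.Sequence.IsWeaklyRegular R [f, g] := by
  by_contra! hcon
  -- If every element of `m` is a zerodivisor modulo `f`, prime avoidance makes `m` the annihilator
  -- of a class `u`, which `h` forces to vanish.
  have hsub : (m : Set R) ⊆ ⋃ p ∈ associatedPrimes R (QuotSMulTop f R), p := by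
    intro g hg
    rw [biUnion_associatedPrimes_eq_compl_regular R]
    intro hreg
    refine hcon g hg ?_
    rw [RingTheory.Sequence.isWeaklyRegular_cons_iff, RingTheory.Sequence.isWeaklyRegular_cons_iff]
    exact ⟨isSMulRegular_iff_right_eq_zero_of_smul.2 hf, hreg, .nil _ _⟩
  obtain ⟨p, hp, hmp⟩ := (Ideal.subset_union_prime_finite
    (associatedPrimes.finite R (QuotSMulTop f R)) (f := id) m m
    (fun p hp _ _ => IsAssociatedPrime.isPrime hp)).1 hsub
  obtain ⟨hprime, x, hx⟩ := isAssociatedPrime_iff.1 (AssociatedPrimes.mem_iff.1 hp)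
  obtain rfl := Ideal.IsMaximal.eq_of_le ‹m.IsMaximal› hprime.ne_top hmp
  obtain ⟨u, rfl⟩ := Submodule.Quotient.mk_surjective _ x
  have hmem : ∀ y : R, (Submodule.Quotient.mk y : QuotSMulTop f R) = 0 ↔ f ∣ y := by
    intro y
    rw [Submodule.Quotient.mk_eq_zero, Submodule.mem_smul_pointwise_iff_exists]
    simp [dvd_def, eq_comm]
  have hu : f ∣ u := by
    refine h u fun r hr => ?_
    rw [hx, Submodule.mem_colon_singleton, ← Submodule.Quotient.mk_smul, Submodule.mem_bot] at hr
    exact (hmem _).1 hr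
  refine hprime.ne_top ((Ideal.eq_top_iff_one _).2 ?_)
  rw [hx, Submodule.mem_colon_singleton, (hmem u).2 hu]
  simp

theorem length_le_ringKrullDim_of_isRegular {R : Type u} [CommRing R] [IsNoetherianRing R]
    [IsLocalRing R] (rs : List R) (hreg : RingTheory.Sequence.IsRegular R rs) :
    (rs.length : WithBot ℕ∞) ≤ ringKrullDim R := by
  rw [← ringKrullDim_add_length_eq_ringKrullDim_of_isRegular rs hreg]
  have : Nontrivial (R ⧸ Ideal.ofList rs) := by
    refine Ideal.Quotient.nontrivial_iff.2 fun htop => hreg.top_ne_smul ?_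
    rw [htop]; simp
  exact le_add_of_nonneg_left ringKrullDim_nonneg_of_nontrivial

theorem localDepth_le_ringKrullDim (R : Type u) [CommRing R] [IsNoetherianRing R]
    [IsLocalRing R] : (localDepth R : WithBot ℕ∞) ≤ ringKrullDim R := by
  obtain ⟨d, hd⟩ : ∃ d : ℕ∞, ringKrullDim R = d :=
    ⟨_, (WithBot.coe_unbot _ ringKrullDim_ne_bot).symm⟩
  rw [hd, WithBot.coe_le_coe]
  refine iSup₂_le fun rs hrs => ?_
  have := length_le_ringKrullDim_of_isRegular rs hrs.2
  rw [hd] at this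
  exact_mod_cast this

/-- A Noetherian ring of dimension at most two is Cohen-Macaulay if every maximal ideal contains a
weakly regular sequence of length two. -/
theorem isCohenMacaulayRing_of_exists_isWeaklyRegular_pair {R : Type u} [CommRing R]
    [IsNoetherianRing R] (hdim : ringKrullDim R ≤ 2)
    (h : ∀ m : Ideal R, m.IsMaximal →
      ∃ f ∈ m, ∃ g ∈ m, RingTheory.Sequence.IsWeaklyRegular R [f, g]) :
    IsCohenMacaulayRing R := by
  refine ⟨inferInstance, fun m hm => ?_⟩
  have : IsNoetherianRing (Localization.AtPrime m) :=
    IsLocalization.isNoetherianRing m.primeCompl _ inferInstance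
  refine ⟨this, (localDepth_le_ringKrullDim _).antisymm ?_⟩
  obtain ⟨f, hf, g, hg, hreg⟩ := h m hm
  have hreg' := hreg.isRegular_of_isLocalization_of_mem (Localization.AtPrime m) m
    (by simp [hf, hg])
  calc ringKrullDim (Localization.AtPrime m) = m.height :=
        IsLocalization.AtPrime.ringKrullDim_eq_height m _
    _ ≤ ringKrullDim R := Ideal.height_le_ringKrullDim_of_ne_top hm.ne_top
    _ ≤ ((2 : ℕ∞) : WithBot ℕ∞) := hdim
    _ ≤ _ := by
      rw [WithBot.coe_le_coe]
      refine le_trans (by simp) (le_iSup₂ (f := fun (rs : List (Localization.AtPrime m)) _ =>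
        (rs.length : ℕ∞)) _ ⟨?_, hreg'⟩)
      intro r hr
      simp only [List.map_cons, List.map_nil, List.mem_cons, List.not_mem_nil, or_false] at hr
      rcases hr with rfl | rfl <;>
        simpa only [IsLocalization.AtPrime.to_map_mem_maximal_iff _ m]

/-- The dimension of a ring is bounded by the dimensions of its quotients by finitely many ideals
whose intersection is zero. -/
theorem ringKrullDim_le_of_iInf_eq_bot {R : Type u} [CommRing R] {ι : Type w} [Finite ι]
    (I : ι → Ideal R) (hI : ⨅ i, I i = ⊥) {n : WithBot ℕ∞}
    (h : ∀ i, ringKrullDim (R ⧸ I i) ≤ n) : ringKrullDim R ≤ n := by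
  refine iSup_le fun l => ?_
  have := Fintype.ofFinite ι
  -- The smallest prime of the chain contains some `I i`, so the whole chain lives in that quotient.
  obtain ⟨i, -, hi⟩ := (Ideal.IsPrime.inf_le' (s := Finset.univ) (f := I)
    l.head.isPrime).1 (by rw [Finset.inf_univ_eq_iInf, hI]; exact bot_le)
  refine le_trans ?_ (h i)
  rw [ringKrullDim_quotient]
  let l' : LTSeries (PrimeSpectrum.zeroLocus (I i : Set R)) :=
    { length := l.length
      toFun := fun j => ⟨l j, hi.trans (l.monotone (Fin.zero_le j))⟩
      step := fun j => l.step j }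
  exact le_iSup (fun l : LTSeries (PrimeSpectrum.zeroLocus (I i : Set R)) =>
    ((l.length : ℕ∞) : WithBot ℕ∞)) l'

namespace FaceComplex

open MvPolynomial

variable {V : Type u} {Γ : FaceComplex V} {K : Type w} [Field K]

theorem IsFreeVertex.eq_of_mem {v : V} (hv : Γ.IsFreeVertex v) {F G : Finset V}
    (hF : Γ.IsFacet F) (hvF : v ∈ F) (hG : Γ.IsFacet G) (hvG : v ∈ G) : G = F :=
  hv.2.unique ⟨hG, hvG⟩ ⟨hF, hvF⟩

/-- The edges of a complex. -/
abbrev Edge (Γ : FaceComplex V) : Type u := {e : Finset V // e ∈ Γ.faces ∧ e.card = 2}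

/-- A complex is a graph without isolated vertices if every face is contained in an edge. -/
def IsGraph (Γ : FaceComplex V) : Prop := ∀ G ∈ Γ.faces, ∃ e : Γ.Edge, G ⊆ e.1

theorem isGraph_pureSkeleton_two : (Γ.pureSkeleton 2).IsGraph := by
  rintro G ⟨e, he, hGe⟩
  exact ⟨⟨e, ⟨e, he, subset_rfl⟩, he.2⟩, hGe⟩

theorem exists_card_eq_of_le {G : Finset V} (hG : G ∈ Γ.faces) {n : ℕ} (hn : n ≤ G.card) :
    ∃ H ∈ Γ.faces, H.card = n := by
  obtain ⟨H, hHG, hH⟩ := Finset.exists_subset_card_eq hn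
  exact ⟨H, Γ.down_closed G hG H hHG, hH⟩

theorem isVertex_pureSkeleton {G : Finset V} (hG : G ∈ Γ.faces) {n : ℕ} (hn0 : 1 ≤ n)
    (hn : n ≤ G.card) {v : V} (hv : v ∈ G) : (Γ.pureSkeleton n).IsVertex v := by
  obtain ⟨H, hvH, hHG, hH⟩ := Finset.exists_subsuperset_card_eq
    (Finset.singleton_subset_iff.2 hv) (by simpa using hn0) hn
  exact ⟨H, ⟨Γ.down_closed G hG H hHG, hH⟩, hvH⟩

theorem isSequentiallyCM_iff : IsSequentiallyCM.{u, w} Γ ↔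
    ∀ (K : Type w) [Field K], Γ.IsSequentiallyCMOver K :=
  ⟨fun h K _ n hn => h n hn K, fun h n hn K _ => h K n hn⟩

variable [DecidableEq V]

/-- Every monomial supported on a face lies on an edge, where the restriction sees its coefficient.
-/
theorem IsGraph.eq_zero_of_restrict (hΓ : Γ.IsGraph) {p : Γ.StanleyReisnerRing K}
    (hp : ∀ e : Γ.Edge, restrict K e.2.1 p = 0) : p = 0 := by
  obtain ⟨p, rfl⟩ := Ideal.Quotient.mk_surjective p
  rw [Ideal.Quotient.eq_zero_iff_mem, mem_stanleyReisnerIdeal]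
  intro d hd hdΓ
  obtain ⟨e, he⟩ := hΓ _ hdΓ
  have := congrArg (coeff d) (hp e)
  rw [restrict_mk, coeff_faceEval, if_pos he, coeff_zero] at this
  exact mem_support_iff.1 hd this

theorem ringKrullDim_quotient_ker_restrict_le {S : Finset V} (hS : S ∈ Γ.faces) :
    ringKrullDim (Γ.StanleyReisnerRing K ⧸ RingHom.ker (restrict K hS)) ≤ S.card := by
  let I := RingHom.ker (restrict K hS)
  let f : MvPolynomial S K →ₐ[K] Γ.StanleyReisnerRing K ⧸ I :=
    aeval fun v : S => Ideal.Quotient.mkₐ K I (Γ.srVar K v)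
  have hf : Function.Surjective f := by
    intro p
    obtain ⟨p, rfl⟩ := Ideal.Quotient.mk_surjective p
    obtain ⟨p, rfl⟩ := Ideal.Quotient.mk_surjective p
    induction p using MvPolynomial.induction_on with
    | C c => exact ⟨C c, f.commutes c⟩
    | add p q hp hq =>
      obtain ⟨p', hp'⟩ := hp
      obtain ⟨q', hq'⟩ := hq
      exact ⟨p' + q', by rw [map_add, hp', hq', map_add, map_add]⟩
    | mul_X p v hp =>
      obtain ⟨p', hp'⟩ := hp
      by_cases hv : v ∈ S
      · refine ⟨p' * X ⟨v, hv⟩, ?_⟩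
        rw [map_mul, hp', map_mul, map_mul]
        congr 1
        exact aeval_X _ _
      · refine ⟨0, ?_⟩
        have : Γ.srVar K v ∈ I := by
          rw [RingHom.mem_ker, restrict_srVar, if_neg hv]
        rw [map_mul, map_mul, map_zero]
        exact (mul_eq_zero_of_right _ (Ideal.Quotient.eq_zero_iff_mem.2 this)).symm
  refine (ringKrullDim_le_of_surjective f.toRingHom hf).trans ?_
  rw [MvPolynomial.ringKrullDim_of_isNoetherianRing, ringKrullDim_eq_zero_of_field]
  simp

theorem IsGraph.ringKrullDim_le [Finite V] (hΓ : Γ.IsGraph) :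
    ringKrullDim (Γ.StanleyReisnerRing K) ≤ 2 := by
  refine ringKrullDim_le_of_iInf_eq_bot (fun e : Γ.Edge => RingHom.ker (restrict K e.2.1)) ?_
    fun e => ?_
  · rw [eq_bot_iff]
    intro p hp
    rw [Ideal.mem_iInf] at hp
    exact hΓ.eq_zero_of_restrict fun e => hp e
  · exact (ringKrullDim_quotient_ker_restrict_le e.2.1).trans_eq
      (congrArg (Nat.cast : ℕ → WithBot ℕ∞) e.2.2)

/-- Polynomials on the edges of a connected graph which agree on the common vertices of any two
edges come from an element of the Stanley-Reisner ring. -/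
theorem FaceConnected.exists_restrict_eq [Finite V] (hconn : Γ.FaceConnected)
    {h : Γ.Edge → MvPolynomial V K}
    (hh : ∀ e : Γ.Edge, faceEval K e.1 (h e) = h e)
    (hcompat : ∀ (e e' : Γ.Edge) (v : V), v ∈ e.1 → v ∈ e'.1 →
      faceEval K {v} (h e) = faceEval K {v} (h e')) :
    ∃ p : Γ.StanleyReisnerRing K, ∀ e : Γ.Edge, restrict K e.2.1 p = h e := by
  have hcoeff : ∀ (e e' : Γ.Edge) (v : V) (d : V →₀ ℕ), v ∈ e.1 → v ∈ e'.1 →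
      d.support ⊆ {v} → coeff d (h e) = coeff d (h e') := by
    intro e e' v d hv hv' hd
    have := congrArg (coeff d) (hcompat e e' v hv hv')
    rwa [coeff_faceEval, coeff_faceEval, if_pos hd, if_pos hd] at this
  -- Only the constant term must agree on disjoint edges; this is where connectedness enters.
  have hconst : ∀ e e' : Γ.Edge, coeff 0 (h e) = coeff 0 (h e') := by
    intro e e'
    obtain ⟨x, hx⟩ := Finset.card_pos.1 (by rw [e.2.2]; norm_num : 0 < e.1.card)
    obtain ⟨y, hy⟩ := Finset.card_pos.1 (by rw [e'.2.2]; norm_num : 0 < e'.1.card)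
    have := hconn {v | ∀ e' : Γ.Edge, v ∈ e'.1 → coeff 0 (h e) = coeff 0 (h e')} ?_ x y
      (Γ.down_closed _ e.2.1 _ (Finset.singleton_subset_iff.2 hx))
      (Γ.down_closed _ e'.2.1 _ (Finset.singleton_subset_iff.2 hy))
      (fun e' hx' => hcoeff e e' x 0 hx hx' (by simp))
    · exact this e' hy
    · intro v w hvw hv e' hw
      by_cases hne : v = w
      · subst hne
        exact hv e' hw
      · let e'' : Γ.Edge := ⟨{v, w}, hvw, Finset.card_pair hne⟩
        rw [hv e'' (by simp [e''])]
        exact hcoeff e'' e' w 0 (by simp [e'']) hw (by simp)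
  have hcoeff' : ∀ (e e' : Γ.Edge) (d : V →₀ ℕ), d.support ⊆ e.1 → d.support ⊆ e'.1 →
      coeff d (h e) = coeff d (h e') := by
    intro e e' d hd hd'
    obtain h0 | ⟨v, hv⟩ := d.support.eq_empty_or_nonempty
    · rw [Finsupp.support_eq_empty] at h0
      rw [h0]
      exact hconst e e'
    by_cases hdv : d.support ⊆ {v}
    · exact hcoeff e e' v d (hd hv) (hd' hv) hdv
    · have hcard : 2 ≤ d.support.card := by
        by_contra hlt
        exact hdv (Finset.eq_of_subset_of_card_le (Finset.singleton_subset_iff.2 hv)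
          (by simp only [Finset.card_singleton]; omega)).symm.subset
      have e1 := Finset.eq_of_subset_of_card_le hd (by rw [e.2.2]; exact hcard)
      have e2 := Finset.eq_of_subset_of_card_le hd' (by rw [e'.2.2]; exact hcard)
      obtain rfl : e = e' := Subtype.ext (e1.symm.trans e2)
      rfl
  classical
  have := Fintype.ofFinite V
  -- The coefficient is read off any edge carrying `d`; the value 0 elsewhere is invisible to
  -- restrictions to edges.
  let c : (V →₀ ℕ) → K := fun d =>
    if H : ∃ e : Γ.Edge, d.support ⊆ e.1 then coeff d (h H.choose) else 0
  have hc : ∀ (e : Γ.Edge) (d : V →₀ ℕ), d.support ⊆ e.1 → c d = coeff d (h e) := by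
    intro e d hd
    have H : ∃ e : Γ.Edge, d.support ⊆ e.1 := ⟨e, hd⟩
    rw [show c d = coeff d (h H.choose) from dif_pos H]
    exact hcoeff' _ _ d H.choose_spec hd
  let D : Finset (V →₀ ℕ) := Finset.univ.biUnion fun e : Γ.Edge => (h e).support
  refine ⟨Ideal.Quotient.mk _ (∑ d ∈ D, monomial d (c d)), fun e => ?_⟩
  ext d
  rw [restrict_mk, coeff_faceEval]
  split_ifs with hd
  · rw [coeff_sum]
    simp only [coeff_monomial, Finset.sum_ite_eq']
    rw [hc e d hd]
    split_ifs with hdD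
    · rfl
    · by_contra hne
      exact hdD (Finset.mem_biUnion.2
        ⟨e, Finset.mem_univ _, mem_support_iff.2 fun h0 => hne h0.symm⟩)
  · rw [← hh e, coeff_faceEval, if_neg hd]

/-- Otherwise prime avoidance puts `m` inside the kernel of one restriction, but `m` contains a
nonzero polynomial in a single variable of that edge. -/
theorem exists_mem_forall_restrict_ne_zero [Finite V] (m : Ideal (Γ.StanleyReisnerRing K))
    [m.IsMaximal] : ∃ f ∈ m, ∀ e : Γ.Edge, restrict K e.2.1 f ≠ 0 := by
  by_contra! hcon
  obtain ⟨e, -, he⟩ := (Ideal.subset_union_prime_finite (Set.toFinite Set.univ)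
    (f := fun e : Γ.Edge => RingHom.ker (restrict K e.2.1))
    (hcon 0 m.zero_mem).choose (hcon 0 m.zero_mem).choose
    (fun e _ _ _ => RingHom.ker_isPrime (restrict K e.2.1)) (I := m)).1 (by
      intro f hf
      obtain ⟨e, he⟩ := hcon f hf
      exact Set.mem_biUnion (Set.mem_univ e) he)
  obtain ⟨v, hv⟩ := Finset.card_pos.1 (by rw [e.2.2]; norm_num : 0 < e.1.card)
  obtain ⟨q, hq, hqm⟩ := exists_aeval_mem_of_isMaximal K m (Γ.srVar K v)
  have := he hqm
  rw [RingHom.mem_ker, restrict_aeval_srVar e.2.1 hv] at this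
  exact aeval_X_ne_zero hq v this

/-- In the Stanley-Reisner ring of a connected graph, no maximal ideal is associated to a
principal ideal generated by a nonzerodivisor. -/
theorem IsGraph.dvd_of_forall_mem_dvd_mul [Finite V] (hΓ : Γ.IsGraph) (hconn : Γ.FaceConnected)
    (m : Ideal (Γ.StanleyReisnerRing K)) [m.IsMaximal] {f u : Γ.StanleyReisnerRing K}
    (hf : ∀ e : Γ.Edge, restrict K e.2.1 f ≠ 0) (hu : ∀ r ∈ m, f ∣ r * u) : f ∣ u := by
  -- Each endpoint of the edge contributes a one-variable polynomial in `m`; the two are coprime.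
  have hdvd : ∀ e : Γ.Edge, restrict K e.2.1 f ∣ restrict K e.2.1 u := by
    intro e
    obtain ⟨x, y, hxy, he⟩ := Finset.card_eq_two.1 e.2.2
    have hx : x ∈ e.1 := by rw [he]; simp
    have hy : y ∈ e.1 := by rw [he]; simp
    obtain ⟨p, hp, hpm⟩ := exists_aeval_mem_of_isMaximal K m (Γ.srVar K x)
    obtain ⟨q, hq, hqm⟩ := exists_aeval_mem_of_isMaximal K m (Γ.srVar K y)
    have h1 := map_dvd (restrict K e.2.1) (hu _ hpm)
    have h2 := map_dvd (restrict K e.2.1) (hu _ hqm)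
    rw [map_mul, restrict_aeval_srVar e.2.1 hx] at h1
    rw [map_mul, restrict_aeval_srVar e.2.1 hy] at h2
    exact dvd_of_dvd_mul_of_isRelPrime (hf e) (isRelPrime_aeval_X hp hq hxy)
      (aeval_X_ne_zero hp x) h1 h2
  have hex : ∀ e : Γ.Edge, ∃ h : MvPolynomial V K, faceEval K e.1 h = h ∧
      restrict K e.2.1 u = restrict K e.2.1 f * h := by
    intro e
    obtain ⟨h, hh⟩ := hdvd e
    refine ⟨faceEval K e.1 h, by rw [faceEval_faceEval, Finset.inter_self], ?_⟩
    have := congrArg (faceEval K e.1) hh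
    rwa [map_mul, faceEval_restrict _ _ subset_rfl, faceEval_restrict _ _ subset_rfl] at this
  choose h hh hfh using hex
  obtain ⟨p, hp⟩ := hconn.exists_restrict_eq hh (by
    intro e e' v hv hv'
    obtain ⟨q, hq, hqm⟩ := exists_aeval_mem_of_isMaximal K m (Γ.srVar K v)
    obtain ⟨c, hc⟩ := hu _ hqm
    -- The quotient `c` is global, so the right side at `v` does not depend on the edge; the factor
    -- `q` cancels.
    have key : ∀ e : Γ.Edge, v ∈ e.1 → Polynomial.aeval (X v) q * faceEval K {v} (h e) =
        faceEval K {v} (restrict K e.2.1 c) := by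
      intro e hv
      have := congrArg (restrict K e.2.1) hc
      rw [map_mul, map_mul, hfh e, restrict_aeval_srVar e.2.1 hv] at this
      have := mul_left_cancel₀ (hf e)
        (by linear_combination this : restrict K e.2.1 f *
          (Polynomial.aeval (X v) q * h e) = restrict K e.2.1 f * restrict K e.2.1 c)
      rw [← this, map_mul, faceEval_aeval_X (Finset.mem_singleton_self v)]
    have hvΓ : {v} ∈ Γ.faces :=
      Γ.down_closed _ e.2.1 _ (Finset.singleton_subset_iff.2 hv)
    have h1 := key e hv
    have h2 := key e' hv'
    rw [faceEval_restrict hvΓ _ (Finset.singleton_subset_iff.2 hv)] at h1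
    rw [faceEval_restrict hvΓ _ (Finset.singleton_subset_iff.2 hv')] at h2
    exact mul_left_cancel₀ (aeval_X_ne_zero hq v) (h1.trans h2.symm))
  refine ⟨p, sub_eq_zero.1 (hΓ.eq_zero_of_restrict fun e => ?_)⟩
  rw [map_sub, map_mul, hp, hfh, sub_self]

/-- Connected graphs are Cohen-Macaulay over every field. -/
theorem IsGraph.isCohenMacaulayOver [Finite V] (hΓ : Γ.IsGraph) (hconn : Γ.FaceConnected) :
    Γ.IsCohenMacaulayOver K := by
  refine isCohenMacaulayRing_of_exists_isWeaklyRegular_pair hΓ.ringKrullDim_le fun m hm => ?_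
  obtain ⟨f, hfm, hf⟩ := exists_mem_forall_restrict_ne_zero m
  refine ⟨f, hfm, exists_isWeaklyRegular_pair m (fun x hx => ?_) fun u hu => ?_⟩
  · refine hΓ.eq_zero_of_restrict fun e => ?_
    have := congrArg (restrict K e.2.1) hx
    rw [map_mul, map_zero] at this
    exact (mul_eq_zero.1 this).resolve_left (hf e)
  · exact hΓ.dvd_of_forall_mem_dvd_mul hconn m hf hu

/-! ### Sequential Cohen–Macaulayness -/

theorem pair_mem_pureSkeleton_two {x y : V} (h : {x, y} ∈ Γ.faces) (hxy : x ≠ y) :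
    {x, y} ∈ (Γ.pureSkeleton 2).faces :=
  ⟨_, ⟨h, Finset.card_pair hxy⟩, subset_rfl⟩

namespace FreePair

variable {a b : V} {E F : Finset V}

/-- A proper subset of `{a, b}` lies in `E` or `F`. -/
theorem mem_add_iff_of_card_ne (h : FreePair Γ a b E F) {G : Finset V} (hG : G.card ≠ 2) :
    G ∈ (Γ + generated {{a, b}}).faces ↔ G ∈ Γ.faces := by
  rw [mem_add_iff, mem_generated_singleton]
  refine or_iff_left_of_imp fun hGab => ?_
  have h2 : ({a, b} : Finset V).card = 2 := Finset.card_pair h.vertex_ne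
  have hle := Finset.card_le_card hGab
  by_cases haG : a ∈ G
  · refine Γ.down_closed E h.left.1 G fun x hx => ?_
    by_contra hxE
    have : {a, b} ⊆ G := by
      intro y hy
      simp only [Finset.mem_insert, Finset.mem_singleton] at hy
      rcases hy with rfl | rfl
      · exact haG
      · have := hGab hx
        simp only [Finset.mem_insert, Finset.mem_singleton] at this
        rcases this with rfl | rfl
        · exact absurd h.mem_left hxE
        · exact hx
    have := Finset.card_le_card this
    omega
  · refine Γ.down_closed F h.right.1 G fun x hx => ?_
    have := hGab hx
    simp only [Finset.mem_insert, Finset.mem_singleton] at this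
    rcases this with rfl | rfl
    · contradiction
    · exact h.mem_right

theorem pureSkeleton_add (h : FreePair Γ a b E F) {n : ℕ} (hn : n ≠ 2) :
    (Γ + generated {{a, b}}).pureSkeleton n = Γ.pureSkeleton n := by
  have : {G | G ∈ (Γ + generated {{a, b}}).faces ∧ G.card = n} =
      {G | G ∈ Γ.faces ∧ G.card = n} := by
    ext G
    simp only [Set.mem_ofPred_eq]
    refine and_congr_left fun hG => h.mem_add_iff_of_card_ne (hG ▸ hn)
  rw [pureSkeleton, this, pureSkeleton]

theorem exists_card_add_iff (h : FreePair Γ a b E F) (n : ℕ) :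
    (∃ G ∈ (Γ + generated {{a, b}}).faces, G.card = n) ↔ ∃ G ∈ Γ.faces, G.card = n := by
  refine ⟨fun ⟨G, hG, hGn⟩ => ?_, fun ⟨G, hG, hGn⟩ => ⟨G, .inl hG, hGn⟩⟩
  by_cases hn : n = 2
  · subst hn
    exact exists_card_eq_of_le h.left.1 h.card_left
  · exact ⟨G, (h.mem_add_iff_of_card_ne (hGn ▸ hn)).1 hG, hGn⟩

theorem isVertex_pureSkeleton_two (h : FreePair Γ a b E F) {v : V}
    (hv : ((Γ + generated {{a, b}}).pureSkeleton 2).IsVertex v) :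
    (Γ.pureSkeleton 2).IsVertex v := by
  obtain ⟨G, ⟨hG, hG2⟩, hvG⟩ := hv
  rw [Finset.singleton_subset_iff] at hvG
  rcases hG with hG | hG
  · exact isVertex_pureSkeleton hG one_le_two hG2.ge hvG
  · have := mem_generated_singleton.1 hG hvG
    simp only [Finset.mem_insert, Finset.mem_singleton] at this
    rcases this with rfl | rfl
    · exact isVertex_pureSkeleton h.left.1 one_le_two h.card_left h.mem_left
    · exact isVertex_pureSkeleton h.right.1 one_le_two h.card_right h.mem_right

theorem pureSkeleton_two_mono {G : Finset V} (hG : G ∈ (Γ.pureSkeleton 2).faces) :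
    G ∈ ((Γ + generated {{a, b}}).pureSkeleton 2).faces := by
  obtain ⟨D, ⟨hD, hD2⟩, hGD⟩ := hG
  exact ⟨D, ⟨.inl hD, hD2⟩, hGD⟩

theorem faceConnected_add (h : FreePair Γ a b E F) (hconn : (Γ.pureSkeleton 2).FaceConnected) :
    ((Γ + generated {{a, b}}).pureSkeleton 2).FaceConnected := fun S hS x y hx hy =>
  hconn S (fun x y hxy => hS x y (pureSkeleton_two_mono hxy)) x y
    (h.isVertex_pureSkeleton_two hx) (h.isVertex_pureSkeleton_two hy)

theorem faceConnected_of_add (h : FreePair Γ a b E F) (hE : 3 ≤ E.card) (hF : 3 ≤ F.card)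
    (hconn : ((Γ + generated {{a, b}}).pureSkeleton 2).FaceConnected)
    (hconn3 : (Γ.pureSkeleton 3).FaceConnected) :
    (Γ.pureSkeleton 2).FaceConnected := by
  intro S hS x y hx hy
  have hS' : ∀ x y, x ≠ y → {x, y} ∈ Γ.faces → x ∈ S → y ∈ S := fun x y hxy hmem =>
    hS x y (pair_mem_pureSkeleton_two hmem hxy)
  -- Edges of the pure 2-skeleton are edges of `Γ`, so `S` cannot separate its vertices, in
  -- particular not `a` from `b`.
  have hab : ∀ x y, (Γ.pureSkeleton 3).IsVertex x → (Γ.pureSkeleton 3).IsVertex y →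
      x ∈ S → y ∈ S := by
    refine hconn3 S fun x y hxy hx => ?_
    by_cases hne : x = y
    · exact hne ▸ hx
    · obtain ⟨D, ⟨hD, -⟩, hxyD⟩ := hxy
      exact hS' x y hne (Γ.down_closed D hD _ hxyD) hx
  have ha := isVertex_pureSkeleton h.left.1 (by norm_num) hE h.mem_left
  have hb := isVertex_pureSkeleton h.right.1 (by norm_num) hF h.mem_right
  refine hconn S (fun x y hxy hxS => ?_) x y ?_ ?_
  · by_cases hne : x = y
    · exact hne ▸ hxS
    obtain ⟨D, ⟨hD | hD, -⟩, hxyD⟩ := hxy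
    · exact hS' x y hne (Γ.down_closed D hD _ hxyD) hxS
    · have hsub := hxyD.trans (mem_generated_singleton.1 hD)
      have hx := hsub (Finset.mem_insert_self x {y})
      have hy := hsub (Finset.mem_insert_of_mem (Finset.mem_singleton_self y))
      simp only [Finset.mem_insert, Finset.mem_singleton] at hx hy
      rcases hx with rfl | rfl <;> rcases hy with rfl | rfl
      · exact hxS
      · exact hab _ _ ha hb hxS
      · exact hab _ _ hb ha hxS
      · exact hxS
  · exact pureSkeleton_two_mono hx
  · exact pureSkeleton_two_mono hy

end FreePair

theorem IsSequentiallyCMOver.faceConnected_pureSkeleton (hΓ : Γ.IsSequentiallyCMOver K) {n : ℕ}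
    (hn : 2 ≤ n) {G : Finset V} (hG : G ∈ Γ.faces) (hGn : n ≤ G.card) :
    (Γ.pureSkeleton n).FaceConnected := by
  obtain ⟨H, hH, hHn⟩ := exists_card_eq_of_le hG hGn
  exact (hΓ n ⟨H, hH, hHn⟩).faceConnected ⟨H, ⟨H, ⟨hH, hHn⟩, subset_rfl⟩, hHn ▸ hn⟩

theorem IsSequentiallyCMOver.add_edge [Finite V] {a b : V} {E F : Finset V}
    (hΓ : Γ.IsSequentiallyCMOver K) (h : FreePair Γ a b E F) :
    (Γ + generated {{a, b}}).IsSequentiallyCMOver K := by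
  intro n hn
  by_cases hn2 : n = 2
  · subst hn2
    exact isGraph_pureSkeleton_two.isCohenMacaulayOver
      (h.faceConnected_add (hΓ.faceConnected_pureSkeleton le_rfl h.left.1 h.card_left))
  · rw [h.pureSkeleton_add hn2]
    exact hΓ n ((h.exists_card_add_iff n).1 hn)

theorem IsSequentiallyCMOver.of_add_edge [Finite V] {a b : V} {E F : Finset V}
    (hΓ : (Γ + generated {{a, b}}).IsSequentiallyCMOver K) (h : FreePair Γ a b E F)
    (hE : 3 ≤ E.card) (hF : 3 ≤ F.card) : Γ.IsSequentiallyCMOver K := by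
  intro n hn
  by_cases hn2 : n = 2
  · subst hn2
    refine isGraph_pureSkeleton_two.isCohenMacaulayOver (h.faceConnected_of_add hE hF
      (hΓ.faceConnected_pureSkeleton le_rfl (.inl h.left.1) h.card_left) ?_)
    have := hΓ.faceConnected_pureSkeleton (n := 3) (by norm_num) (.inl h.left.1) hE
    rwa [h.pureSkeleton_add (by norm_num)] at this
  · rw [← h.pureSkeleton_add hn2]
    exact hΓ n ((h.exists_card_add_iff n).2 hn)

end FaceComplex

theorem mainTheorem9 {V : Type u} [Finite V] [DecidableEq V] (Γ : FaceComplex V)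
    (a b : V) (E F : Finset V)
    (ha : Γ.IsFreeVertex a) (hb : Γ.IsFreeVertex b)
    (hE : Γ.IsFacet E) (hF : Γ.IsFacet F) (haE : a ∈ E) (hbF : b ∈ F)
    (hFE : F ≠ E) (hE2 : 2 ≤ E.card) (hF2 : 2 ≤ F.card) :
    ((Γ.IsVertexDecomposable →
        (Γ + FaceComplex.generated {{a, b}}).IsVertexDecomposable) ∧
      (Γ.IsShellable → (Γ + FaceComplex.generated {{a, b}}).IsShellable) ∧
      (FaceComplex.IsSequentiallyCM.{u, w} Γ →
        FaceComplex.IsSequentiallyCM.{u, w} (Γ + FaceComplex.generated {{a, b}})) ∧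
      (∀ (K : Type w) [Field K], Γ.IsSequentiallyCMOver K →
        (Γ + FaceComplex.generated {{a, b}}).IsSequentiallyCMOver K)) ∧
    (3 ≤ E.card → 3 ≤ F.card →
      ((Γ + FaceComplex.generated {{a, b}}).IsVertexDecomposable →
        Γ.IsVertexDecomposable) ∧
      ((Γ + FaceComplex.generated {{a, b}}).IsShellable → Γ.IsShellable) ∧
      (FaceComplex.IsSequentiallyCM.{u, w} (Γ + FaceComplex.generated {{a, b}}) →
        FaceComplex.IsSequentiallyCM.{u, w} Γ) ∧
      (∀ (K : Type w) [Field K],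
        (Γ + FaceComplex.generated {{a, b}}).IsSequentiallyCMOver K →
          Γ.IsSequentiallyCMOver K)) := by
  have h : FaceComplex.FreePair Γ a b E F :=
    ⟨hE, hF, haE, hbF, fun _ hG haG => ha.eq_of_mem hE haE hG haG,
      fun _ hG hbG => hb.eq_of_mem hF hbF hG hbG, hFE.symm, hE2, hF2⟩
  simp only [FaceComplex.isSequentiallyCM_iff]
  exact ⟨⟨fun hΓ => hΓ.add_edge h, fun hΓ => hΓ.add_edge h, fun hΓ K _ => (hΓ K).add_edge h,
      fun K _ hΓ => hΓ.add_edge h⟩,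
    fun hE3 hF3 => ⟨fun hΓ => hΓ.of_add_edge h hE3 hF3, fun hΓ => hΓ.of_add_edge h hE3 hF3,
      fun hΓ K _ => (hΓ K).of_add_edge h hE3 hF3, fun K _ hΓ => hΓ.of_add_edge h hE3 hF3⟩⟩
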